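/- An \emph{L-drawing} of a finite digraph (without loops; antiparallel edges are allowed) places its vertices at points of the plane with pairwise distinct $x$-coordinates and pairwise distinct $y$-coordinates and draws each edge $(u,v)$ as the vertical segment incident to the tail $u$ followed by the horizontal segment incident to the head $v$. Edges may overlap in a segment ending at a common tail or a common head. The drawing is \emph{planar} if no two edges cross. A plane digraph comes with a clockwise cyclic order of the edges around each vertex and with an outer face, and a planar L-drawing of a plane digraph has to have these cyclic orders and this outer face; edges at the same port of a vertex $v$ are ordered clockwise as follows: first the edges bending to the left with increasing length of the segment incident to $v$, then those bending to the right with decreasing length. A \emph{port assignment} gives each edge $e$ a pair $(\mathrm{out}(e),\mathrm{in}(e))\in\{\text{North},\text{South}\}\times\{\text{East},\text{West}\}$. An L-drawing \emph{realizes} it if each edge $e=(v,w)$ leaves $v$ at its $\mathrm{out}(e)$ port and enters $w$ at its $\mathrm{in}(e)$ port. The port assignment \emph{admits} a planar L-drawing if some planar L-drawing of the plane digraph realizes it. \textbf{Theorem.} Let $G=(V,E)$ be a finite connected plane digraph all of whose faces, including the outer one, are triangles, with a port assignment that admits a planar L-drawing. Let $X$ and $Y$ be the digraphs with vertex set $V$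 and the following edges: for each edge $e=(v,w)\in E$, \begin{itemize} \item $(v,w)$ is in $X$ if $\mathrm{in}(e)=\text{West}$, and $(w,v)$ is in $X$ if $\mathrm{in}(e)=\text{East}$; \item $(v,w)$ is in $Y$ if $\mathrm{out}(e)=\text{North}$, and $(w,v)$ is in $Y$ if $\mathrm{out}(e)=\text{South}$. \end{itemize} Then $X$ and $Y$ are acyclic. Moreover, let $x$ and $y$ be any topological orderings of $X$ and $Y$, respectively, given by pairwise distinct real labels that increase along every edge. Then drawing each vertex $v$ at the point $(x(v),y(v))$ yields a planar L-drawing of the plane digraph $G$ realizing the given port assignment. -/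

import Mathlib

open Filter Topology

/-- The two ends of a directed edge. -/
inductive EdgeSide where
  | tail
  | head

/-- An edge end (dart): a directed edge of `E` together with one of its two ends. The dart is
attached to that end; as an oriented edge it runs from that end to the opposite one. -/
abbrev Dart {V : Type*} (E : Finset (V × V)) : Type _ := {e : V × V // e ∈ E} × EdgeSide

namespace Dart

variable {V : Type*} {E : Finset (V × V)}

/-- The directed edge underlying a dart. -/
def edge (d : Dart E) : V × V := d.1.1

/-- The vertex a dart is attached to. -/
def vertex (d : Dart E) : V :=
  match d.2 with
  | EdgeSide.tail => d.1.1.1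
  | EdgeSide.head => d.1.1.2

/-- The other end of the same edge. -/
def flip (d : Dart E) : Dart E :=
  match d.2 with
  | EdgeSide.tail => (d.1, EdgeSide.head)
  | EdgeSide.head => (d.1, EdgeSide.tail)

theorem flip_flip (d : Dart E) : d.flip.flip = d := by
  rcases d with ⟨e, s⟩
  cases s <;> rfl

/-- `flip` as a permutation of the darts. -/
def flipPerm (E : Finset (V × V)) : Equiv.Perm (Dart E) where
  toFun := flip
  invFun := flip
  left_inv := flip_flip
  right_inv := flip_flip

end Dart

/-- A loopless digraph (antiparallel pairs of edges are allowed) with a rotation system: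
`rot` sends every edge end to the next one in clockwise order around the same vertex. -/
structure RotationDigraph (V : Type*) where
  edges : Finset (V × V)
  loopless : ∀ v : V, (v, v) ∉ edges
  rot : Equiv.Perm (Dart edges)
  /-- The cycles of `rot` are exactly the sets of edge ends at the vertices. -/
  rot_sameCycle_iff : ∀ d d' : Dart edges, rot.SameCycle d d' ↔ d.vertex = d'.vertex

namespace RotationDigraph

variable {V : Type*} (G : RotationDigraph V)

/-- Walk along the dart to its other end and continue with the clockwise next edge there.
The cycles of this permutation are the facial walks; a walk has its face on its left. -/
def facePerm : Equiv.Perm (Dart G.edges) := (Dart.flipPerm G.edges).trans G.rot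

/-- The faces, as cycles of the face permutation. -/
abbrev Face : Type _ := Quotient (Equiv.Perm.SameCycle.setoid G.facePerm)

/-- The face to the left of a dart. -/
def leftFace (d : Dart G.edges) : G.Face := Quotient.mk _ d

end RotationDigraph

/-- A connected plane digraph (with at least one edge), given by a rotation system
of a planar embedding (one that satisfies Euler's formula) and its outer face. -/
structure PlaneDigraph (V : Type*) extends RotationDigraph V where
  connected : ∀ u v : V, Relation.EqvGen (fun a b => (a, b) ∈ edges) u v
  euler : Nat.card V + Nat.card toRotationDigraph.Face = edges.card + 2
  outerFace : toRotationDigraph.Face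

namespace PlaneDigraph

variable {V : Type*}

/-- Every face, the outer one included, is a triangle: all facial walks have length three.
(As there are no loops, the three vertices of such a walk are distinct.) -/
def IsTriangulated (G : PlaneDigraph V) : Prop :=
  ∀ d : Dart G.edges, G.facePerm d ≠ d ∧ G.facePerm (G.facePerm (G.facePerm d)) = d

end PlaneDigraph

/-- The four ports of a vertex. -/
inductive Port where
  | north
  | east
  | south
  | west

/-- The clockwise position of a port, starting at North. -/
def Port.index : Port → ℕ
  | Port.north => 0
  | Port.east => 1
  | Port.south => 2
  | Port.west => 3

/-- The ports for outgoing edges. -/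
inductive OutPort where
  | north
  | south

/-- The ports for incoming edges. -/
inductive InPort where
  | east
  | west

def OutPort.toPort : OutPort → Port
  | OutPort.north => Port.north
  | OutPort.south => Port.south

def InPort.toPort : InPort → Port
  | InPort.east => Port.east
  | InPort.west => Port.west

/-- A port assignment: every edge `e` gets a pair `(out e, in e)` in
`{North, South} × {East, West}`. -/
structure PortAssignment {V : Type*} (G : PlaneDigraph V) where
  outPort : {e : V × V // e ∈ G.edges} → OutPort
  inPort : {e : V × V // e ∈ G.edges} → InPort

/-! ### L-drawings

A placement of the vertices at the points `(x v, y v)` determines the L-drawing: the edge `(u, v)`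
is the vertical segment from `u` to the bend `(x u, y v)` followed by the horizontal segment from
the bend to `v`. -/

namespace LDrawing

variable {V : Type*} (x y : V → ℝ)

/-- The point representing a vertex. -/
def point (v : V) : ℝ × ℝ := (x v, y v)

/-- The bend of an edge. -/
def bend (e : V × V) : ℝ × ℝ := (x e.1, y e.2)

/-- The vertical segment of an edge, incident to its tail. -/
def vertical (e : V × V) : Set (ℝ × ℝ) := segment ℝ (point x y e.1) (bend x y e)

/-- The horizontal segment of an edge, incident to its head. -/
def horizontal (e : V × V) : Set (ℝ × ℝ) := segment ℝ (bend x y e) (point x y e.2)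

/-- The polyline representing an edge. -/
def polyline (e : V × V) : Set (ℝ × ℝ) := vertical x y e ∪ horizontal x y e

/-- The set of all points of the drawing. -/
def drawing (E : Finset (V × V)) : Set (ℝ × ℝ) :=
  Set.range (point x y) ∪ ⋃ e ∈ E, polyline x y e

/-- No two edges cross: a common point of two distinct edges is a common end vertex, or lies on
the vertical segments of both at a common tail, or on the horizontal segments of both at a
common head. -/
def NonCrossing (E : Finset (V × V)) : Prop :=
  ∀ e ∈ E, ∀ f ∈ E, e ≠ f → ∀ p ∈ polyline x y e ∩ polyline x y f,
    (∃ v : V, (v = e.1 ∨ v = e.2) ∧ (v = f.1 ∨ v = f.2) ∧ p = point x y v) ∨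
    (e.1 = f.1 ∧ p ∈ vertical x y e ∩ vertical x y f) ∨
    (e.2 = f.2 ∧ p ∈ horizontal x y e ∩ horizontal x y f)

variable {E : Finset (V × V)}

open Classical in
/-- The port an edge end uses in the drawing: the direction of the segment from the vertex of the
dart to the bend. -/
noncomputable def port (d : Dart E) : Port :=
  let w := bend x y d.edge - point x y d.vertex
  if 0 < w.2 then Port.north
  else if 0 < w.1 then Port.east
  else if w.2 < 0 then Port.south
  else Port.west

/-- Counterclockwise rotation of a vector by a right angle. -/
def rotateLeft (a : ℝ × ℝ) : ℝ × ℝ := (-a.2, a.1)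

/-- Walking along the dart, the edge turns to the left at its bend. -/
def BendsLeft (d : Dart E) : Prop :=
  let a := bend x y d.edge - point x y d.vertex
  let b := point x y d.flip.vertex - bend x y d.edge
  0 < a.1 * b.2 - a.2 * b.1

/-- The length of the segment of the edge that is incident to the vertex of the dart. -/
noncomputable def armLength (d : Dart E) : ℝ := dist (point x y d.vertex) (bend x y d.edge)

/-- The clockwise order of the edge ends at one port: first those bending to the left with
increasing length of the incident segment, then those bending to the right with
decreasing length. -/
def PortBefore (d d' : Dart E) : Prop :=
  (BendsLeft x y d ∧ BendsLeft x y d' ∧ armLength x y d < armLength x y d') ∨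
  (BendsLeft x y d ∧ ¬ BendsLeft x y d') ∨
  (¬ BendsLeft x y d ∧ ¬ BendsLeft x y d' ∧ armLength x y d' < armLength x y d)

/-- The clockwise order of the edge ends at a vertex, cut open before the North port. -/
def Before (d d' : Dart E) : Prop :=
  (port x y d).index < (port x y d').index ∨
  (port x y d = port x y d' ∧ PortBefore x y d d')

/-- Walking clockwise around a common vertex from `a` one meets `b` strictly before `c`. -/
def ClockwiseBetween (a b c : Dart E) : Prop :=
  (Before x y a b ∧ Before x y b c) ∨
  (Before x y b c ∧ Before x y c a) ∨
  (Before x y c a ∧ Before x y a b)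

/-- The drawing has the clockwise cyclic orders of edge ends prescribed by the rotation system:
around every vertex, no edge end lies strictly between an edge end and its prescribed
clockwise successor. -/
def RespectsRotation (G : RotationDigraph V) : Prop :=
  ∀ d d' : Dart G.edges, d'.vertex = d.vertex → ¬ ClockwiseBetween x y d d' (G.rot d)

/-- The outer region: points off the drawing in an unbounded component of the complement. -/
def outerRegion (E : Finset (V × V)) : Set (ℝ × ℝ) :=
  {q | q ∉ drawing x y E ∧
    ¬ Bornology.IsBounded (connectedComponentIn (drawing x y E)ᶜ q)}

/-- The outer region lies immediately to the left of the oriented segment from `a` to `b`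
of the edge `e`, at some point of that open segment which is on no other edge. -/
def OuterLeftOfSegment (E : Finset (V × V)) (e : V × V) (a b : ℝ × ℝ) : Prop :=
  ∃ p ∈ openSegment ℝ a b, (∀ f ∈ E, f ≠ e → p ∉ polyline x y f) ∧
    ∀ᶠ ε : ℝ in 𝓝[>] 0, p + ε • rotateLeft (b - a) ∈ outerRegion x y E

/-- The dart, as an oriented edge, has the outer region to its left. -/
def OuterLeft (d : Dart E) : Prop :=
  OuterLeftOfSegment x y E d.edge (point x y d.vertex) (bend x y d.edge) ∨
  OuterLeftOfSegment x y E d.edge (bend x y d.edge) (point x y d.flip.vertex)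

/-- Placing every vertex `v` at `(x v, y v)` yields a planar L-drawing of the plane digraph `G`. -/
structure IsPlanarLDrawing (G : PlaneDigraph V) : Prop where
  x_injective : Function.Injective x
  y_injective : Function.Injective y
  nonCrossing : NonCrossing x y G.edges
  rotation : RespectsRotation x y G.toRotationDigraph
  outer : ∀ d : Dart G.edges, OuterLeft x y d ↔ G.leftFace d = G.outerFace

/-- The L-drawing realizes the port assignment. -/
def Realizes {G : PlaneDigraph V} (P : PortAssignment G) : Prop :=
  ∀ e : {e : V × V // e ∈ G.edges},
    port x y ((e, EdgeSide.tail) : Dart G.edges) = (P.outPort e).toPort ∧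
    port x y ((e, EdgeSide.head) : Dart G.edges) = (P.inPort e).toPort

end LDrawing

namespace PortAssignment

variable {V : Type*} {G : PlaneDigraph V} (P : PortAssignment G)

/-- Some planar L-drawing of the plane digraph realizes the port assignment. -/
def AdmitsPlanarLDrawing : Prop :=
  ∃ x y : V → ℝ, LDrawing.IsPlanarLDrawing x y G ∧ LDrawing.Realizes x y P

/-- The digraph `X`: for `e = (v, w)` it has `(v, w)` if `in e = West` and `(w, v)` if
`in e = East`. -/
def digraphX : Digraph V where
  Adj a b :=
    (∃ h : (a, b) ∈ G.edges, P.inPort ⟨(a, b), h⟩ = InPort.west) ∨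
    (∃ h : (b, a) ∈ G.edges, P.inPort ⟨(b, a), h⟩ = InPort.east)

/-- The digraph `Y`: for `e = (v, w)` it has `(v, w)` if `out e = North` and `(w, v)` if
`out e = South`. -/
def digraphY : Digraph V where
  Adj a b :=
    (∃ h : (a, b) ∈ G.edges, P.outPort ⟨(a, b), h⟩ = OutPort.north) ∨
    (∃ h : (b, a) ∈ G.edges, P.outPort ⟨(b, a), h⟩ = OutPort.south)

end PortAssignment

/-- There is no directed cycle. -/
def Digraph.IsAcyclic {V : Type*} (D : Digraph V) : Prop :=
  ∀ v : V, ¬ Relation.TransGen D.Adj v v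

/-- A topological ordering, given by distinct real labels that increase along the edges. -/
structure Digraph.IsTopologicalOrdering {V : Type*} (D : Digraph V) (t : V → ℝ) : Prop where
  injective : Function.Injective t
  lt_of_adj : ∀ v w : V, D.Adj v w → t v < t w

/-! ### Bend, port and order of edge ends in terms of comparisons of coordinates -/

/-! For the two ends of an edge, the ports prescribe which end has the larger x- and which the
larger y-coordinate, and `X` and `Y` record exactly these comparisons. The given drawing is
therefore itself a pair of topological orderings, which gives acyclicity, and any other pair agrees
with it on the two ends of every edge. Nothing is known about non-adjacent vertices. But all faces
are triangles, so any two corners of a face are adjacent, and the drawn shape of each face is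
determined: whether its edges cross, and its total turn in quarter turns, which is 4
(counterclockwise) or -4 (clockwise).

The bridge from local to global is the condition `Good`: every facial triangle is free of crossings
and exactly one face is drawn clockwise. It depends only on comparisons along edges (`good_congr`).
It holds for the given drawing by Euler's formula, since in the sum of all turns the bends and the
port indices cancel and every vertex contributes one full turn (`good_of_euler`).

Conversely, `Good` drawings are planar. To a face and a point assign the winding number, plus one
for the clockwise face, which is the outside of its triangle. This number `chi` is 0 or 1, and it
sums to one over the faces because the two darts of an edge contribute oppositely: the faces tile
the plane. A proper crossing would place a nearby point in two different faces
(`no_cross_north_west`). The rotation is respected iff there is exactly one descent around every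
vertex, and a descent compares consecutive edge ends, whose far ends are adjacent
(`before_rot_congr`). The darts with the outer region on their left are those of the clockwise face
(`outerLeft_iff_turn`), so the outer face carries over.

Statements about one triangle are finite checks on Booleans. A point enters through two monotone
indicators, telling which vertices lie east and north of it; this also covers points infinitesimally
close to a segment. -/

namespace LShape

/-- Whether an edge end turns left at its bend; `t` tells whether it is the tail end, `bx` and
`by'` whether the far end has the larger `x` and `y` coordinate. -/
def left (t bx by' : Bool) : Bool :=
  if t then xor by' bx else by' == bx

/-- The index of the port of an edge end. -/
def idx (t bx by' : Bool) : ℤ :=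
  if t then (if by' then 0 else 2) else (if bx then 1 else 3)

/-- The first of two edge ends at one port has the shorter arm; `cx`, `cy` compare the far ends. -/
def shorter (t bx by' cx cy : Bool) : Bool :=
  if t then by' == cy else bx == cx

/-- The clockwise order of two edge ends at one port. -/
def portBefore (t bx by' t' bx' by'' cx cy : Bool) : Bool :=
  (left t bx by' && left t' bx' by'' && shorter t bx by' cx cy) ||
  (left t bx by' && !left t' bx' by'') ||
  (!left t bx by' && !left t' bx' by'' && !shorter t bx by' cx cy)

/-- The clockwise order of two edge ends at a vertex, cut open before the North port. -/
def before (t bx by' t' bx' by'' cx cy : Bool) : Bool :=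
  decide (idx t bx by' < idx t' bx' by'') ||
  (decide (idx t bx by' = idx t' bx' by'') && portBefore t bx by' t' bx' by'' cx cy)

/-- An indicator as an integer. -/
def ind (b : Bool) : ℤ := if b then 1 else 0

/-- The turn along an edge and at the following corner of a facial triangle `0 → 1 → 2 → 0`. -/
def turnAt (o₀ o₁ x₀ x₁ x₂ y₀ y₁ y₂ : Bool) : ℤ :=
  (if left o₀ x₀ y₀ then 1 else -1) + 2 -
    (idx o₁ x₁ y₁ - idx (!o₀) (!x₀) (!y₀) +
      4 * ind (before o₁ x₁ y₁ (!o₀) (!x₀) (!y₀) x₂ y₂))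

/-- The total turn along a facial triangle. -/
def turn (o₀ o₁ o₂ x₀ x₁ x₂ y₀ y₁ y₂ : Bool) : ℤ :=
  turnAt o₀ o₁ x₀ x₁ x₂ y₀ y₁ y₂ + turnAt o₁ o₂ x₁ x₂ x₀ y₁ y₂ y₀ +
    turnAt o₂ o₀ x₂ x₀ x₁ y₂ y₀ y₁

/-- Two consecutive edges of a triangle cross. -/
def cross (o₀ o₁ x₀ x₁ x₂ y₀ y₁ y₂ : Bool) : Bool :=
  (o₀ && o₁ && x₀ == x₂ && y₁ == y₂) || (!o₀ && !o₁ && x₁ == x₂ && y₀ == y₂)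

/-- No two edges of a triangle cross. -/
def simple (o₀ o₁ o₂ x₀ x₁ x₂ y₀ y₁ y₂ : Bool) : Bool :=
  !cross o₀ o₁ x₀ x₁ x₂ y₀ y₁ y₂ && !cross o₁ o₂ x₁ x₂ x₀ y₁ y₂ y₀ &&
    !cross o₂ o₀ x₂ x₀ x₁ y₂ y₀ y₁

/-- Three comparisons along a cycle are consistent. -/
def acyclic (x₀ x₁ x₂ : Bool) : Bool := !(x₀ == x₁ && x₁ == x₂)

/-- The contribution of an edge to the winding number. -/
def wind (o a a' b b' : Bool) : ℤ :=
  if o then ind a * (ind b' - ind b) else - (ind a' * (ind b - ind b'))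

/-- The winding number of a triangle. -/
def winding (o₀ o₁ o₂ a₀ a₁ a₂ b₀ b₁ b₂ : Bool) : ℤ :=
  wind o₀ a₀ a₁ b₀ b₁ + wind o₁ a₁ a₂ b₁ b₂ + wind o₂ a₂ a₀ b₂ b₀

/-- Monotonicity of an indicator along one comparison. -/
def mono (c a a' : Bool) : Bool := if c then !a || a' else !a' || a

/-- The three vertices of a triangle are on consistent sides. -/
def mono₃ (x₀ x₁ x₂ a₀ a₁ a₂ : Bool) : Bool := mono x₀ a₀ a₁ && mono x₁ a₁ a₂ && mono x₂ a₂ a₀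

/-- The vertical segment of an edge meets the ray to the east (`e = true`) or west. -/
def hit (e o a a' b b' : Bool) : Bool := (xor b b') && ((if o then a else a') == e)

/-- The ray to the east (`e = true`) or west meets no vertical segment of the triangle. -/
def free (e o₀ o₁ o₂ a₀ a₁ a₂ b₀ b₁ b₂ : Bool) : Bool :=
  !hit e o₀ a₀ a₁ b₀ b₁ && !hit e o₁ a₁ a₂ b₁ b₂ && !hit e o₂ a₂ a₀ b₂ b₀

/-- A closed curve without crossings makes one full turn, to the left or to the right. The `acyclic`
Booleans run through all orders of three vertices. -/
theorem turn_eq : ∀ o₀ o₁ o₂ x₀ x₁ x₂ y₀ y₁ y₂ : Bool, acyclic x₀ x₁ x₂ → acyclic y₀ y₁ y₂ →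
    simple o₀ o₁ o₂ x₀ x₁ x₂ y₀ y₁ y₂ →
    turn o₀ o₁ o₂ x₀ x₁ x₂ y₀ y₁ y₂ = 4 ∨ turn o₀ o₁ o₂ x₀ x₁ x₂ y₀ y₁ y₂ = -4 := by
  decide +kernel

/-- The quarter turn from `(x, y)` to `(-y, x)` exchanges vertical and horizontal segments, so it
has to be combined with a reversal of all edges. -/
theorem turn_rotate : ∀ o₀ o₁ o₂ x₀ x₁ x₂ y₀ y₁ y₂ : Bool,
    acyclic x₀ x₁ x₂ → acyclic y₀ y₁ y₂ → simple o₀ o₁ o₂ x₀ x₁ x₂ y₀ y₁ y₂ →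
    turn (!o₀) (!o₁) (!o₂) (!y₀) (!y₁) (!y₂) x₀ x₁ x₂ = turn o₀ o₁ o₂ x₀ x₁ x₂ y₀ y₁ y₂ := by
  decide +kernel

/-- A simple closed curve winds once around its inside, in the sense of its total turn, and not at
all around its outside. -/
theorem winding_of_turn : ∀ o₀ o₁ o₂ x₀ x₁ x₂ y₀ y₁ y₂ : Bool,
    acyclic x₀ x₁ x₂ → acyclic y₀ y₁ y₂ → simple o₀ o₁ o₂ x₀ x₁ x₂ y₀ y₁ y₂ →
    ∀ a₀ a₁ a₂ : Bool, mono₃ x₀ x₁ x₂ a₀ a₁ a₂ → ∀ b₀ b₁ b₂ : Bool, mono₃ y₀ y₁ y₂ b₀ b₁ b₂ →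
    winding o₀ o₁ o₂ a₀ a₁ a₂ b₀ b₁ b₂ = 0 ∨
      4 * winding o₀ o₁ o₂ a₀ a₁ a₂ b₀ b₁ b₂ = turn o₀ o₁ o₂ x₀ x₁ x₂ y₀ y₁ y₂ := by
  decide +kernel

/-- At a corner where both edges use the same vertical port and the clockwise successor is sorted
first, the angle of the face is a full turn: the face surrounds a spike and is the outside of its
triangle. On a horizontal line meeting both segments of the spike their contributions cancel, and
the third edge misses the line. -/
theorem turn_of_spike : ∀ o₂ x₀ x₁ x₂ y₀ y₁ y₂ : Bool,
    acyclic x₀ x₁ x₂ → acyclic y₀ y₁ y₂ → simple false true o₂ x₀ x₁ x₂ y₀ y₁ y₂ →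
    (!y₀) = y₁ → portBefore true x₁ y₁ true (!x₀) (!y₀) x₂ y₂ →
    turn false true o₂ x₀ x₁ x₂ y₀ y₁ y₂ = -4 ∧
    ∀ a₀ a₁ a₂ : Bool, mono₃ x₀ x₁ x₂ a₀ a₁ a₂ → ∀ b₀ b₁ b₂ : Bool, mono₃ y₀ y₁ y₂ b₀ b₁ b₂ →
    b₀ ≠ b₁ → b₂ ≠ b₁ → winding false true o₂ a₀ a₁ a₂ b₀ b₁ b₂ = 0 := by
  decide +kernel

/-- A horizontal line separates the ends of none or two of the three edges. One vertical segment on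
either side of the point would make the winding number nonzero. -/
theorem exists_free_ray : ∀ o₀ o₁ o₂ x₀ x₁ x₂ y₀ y₁ y₂ : Bool,
    acyclic x₀ x₁ x₂ → acyclic y₀ y₁ y₂ → simple o₀ o₁ o₂ x₀ x₁ x₂ y₀ y₁ y₂ →
    turn o₀ o₁ o₂ x₀ x₁ x₂ y₀ y₁ y₂ = -4 →
    ∀ a₀ a₁ a₂ : Bool, mono₃ x₀ x₁ x₂ a₀ a₁ a₂ → ∀ b₀ b₁ b₂ : Bool, mono₃ y₀ y₁ y₂ b₀ b₁ b₂ →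
    winding o₀ o₁ o₂ a₀ a₁ a₂ b₀ b₁ b₂ = 0 →
    free true o₀ o₁ o₂ a₀ a₁ a₂ b₀ b₁ b₂ ∨ free false o₀ o₁ o₂ a₀ a₁ a₂ b₀ b₁ b₂ := by
  decide +kernel

/-- The winding number computed from the horizontal segments. -/
theorem winding_eq_horizontal : ∀ o₀ o₁ o₂ a₀ a₁ a₂ b₀ b₁ b₂ : Bool,
    winding o₀ o₁ o₂ a₀ a₁ a₂ b₀ b₁ b₂ =
      winding (!o₀) (!o₁) (!o₂) b₀ b₁ b₂ (!a₀) (!a₁) (!a₂) := by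
  decide +kernel

end LShape

/-! ### Triangulated maps with coordinates -/

/-- A rotation system on a type of darts all of whose facial walks are triangles. -/
structure TriMap (V D : Type*) where
  flip : D → D
  rot : Equiv.Perm D
  vtx : D → V
  tail : D → Bool
  flip_flip : ∀ d, flip (flip d) = d
  tail_flip : ∀ d, tail (flip d) = !tail d
  vtx_rot : ∀ d, vtx (rot d) = vtx d
  vtx_flip_ne : ∀ d, vtx (flip d) ≠ vtx d
  rot_flip_iterate : ∀ d, rot (flip (rot (flip (rot (flip d))))) = d
  ext : ∀ d d', vtx d = vtx d' → vtx (flip d) = vtx (flip d') → tail d = tail d' → d = d'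

namespace TriMap

variable {V D : Type*} (S : TriMap V D)

/-- The other end vertex of a dart. -/
def far (d : D) : V := S.vtx (S.flip d)

/-- The next dart along the facial walk. -/
def next (d : D) : D := S.rot (S.flip d)

@[simp] theorem far_flip (d : D) : S.far (S.flip d) = S.vtx d := by simp [far, S.flip_flip]

@[simp] theorem vtx_flip (d : D) : S.vtx (S.flip d) = S.far d := rfl

@[simp] theorem vtx_next (d : D) : S.vtx (S.next d) = S.far d := by simp [next, S.vtx_rot]

@[simp] theorem next_next_next (d : D) : S.next (S.next (S.next d)) = d := S.rot_flip_iterate d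

theorem far_ne (d : D) : S.far d ≠ S.vtx d := S.vtx_flip_ne d

@[simp] theorem far_next_next (d : D) : S.far (S.next (S.next d)) = S.vtx d := by
  rw [← S.vtx_next, next_next_next]

theorem far_next_ne (d : D) : S.far (S.next d) ≠ S.vtx d := by
  have := S.far_ne (S.next (S.next d))
  rw [far_next_next, vtx_next] at this
  exact this.symm

theorem far_next_ne_far (d : D) : S.far (S.next d) ≠ S.far d := by
  have := S.far_ne (S.next d)
  rwa [vtx_next] at this

theorem next_ne (d : D) : S.next d ≠ d := fun h => S.far_ne d (by rw [← S.vtx_next, h])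

theorem next_next_ne (d : D) : S.next (S.next d) ≠ d := fun h =>
  S.next_ne d (by rw [← congrArg S.next h, next_next_next])

/-- The same map with all edges reversed. -/
def reverse : TriMap V D where
  flip := S.flip
  rot := S.rot
  vtx := S.vtx
  tail d := !S.tail d
  flip_flip := S.flip_flip
  tail_flip d := by rw [S.tail_flip]
  vtx_rot := S.vtx_rot
  vtx_flip_ne := S.vtx_flip_ne
  rot_flip_iterate := S.rot_flip_iterate
  ext d d' h h' h'' := S.ext d d' h h' (by simpa using h'')

@[simp] theorem reverse_vtx (d : D) : S.reverse.vtx d = S.vtx d := rfl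
@[simp] theorem reverse_far (d : D) : S.reverse.far d = S.far d := rfl
@[simp] theorem reverse_next (d : D) : S.reverse.next d = S.next d := rfl
@[simp] theorem reverse_flip (d : D) : S.reverse.flip d = S.flip d := rfl
@[simp] theorem reverse_tail (d : D) : S.reverse.tail d = !S.tail d := rfl

/-! ### Shape of darts and faces for given coordinates -/

section Coordinates

variable (x y : V → ℝ)

/-- The far end of a dart has the larger coordinate. -/
noncomputable def up (x : V → ℝ) (d : D) : Bool := decide (x (S.vtx d) < x (S.far d))

/-- The dart turns left at its bend. -/
noncomputable def left (d : D) : Bool := LShape.left (S.tail d) (S.up x d) (S.up y d)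

/-- The index of the port of a dart. -/
noncomputable def idx (d : D) : ℤ := LShape.idx (S.tail d) (S.up x d) (S.up y d)

/-- The length of the arm of a dart at its vertex. -/
noncomputable def arm (d : D) : ℝ :=
  if S.tail d then |y (S.far d) - y (S.vtx d)| else |x (S.far d) - x (S.vtx d)|

/-- The clockwise order of darts at one port. -/
def PortBefore (d d' : D) : Prop :=
  (S.left x y d = true ∧ S.left x y d' = true ∧ S.arm x y d < S.arm x y d') ∨
  (S.left x y d = true ∧ S.left x y d' = false) ∨
  (S.left x y d = false ∧ S.left x y d' = false ∧ S.arm x y d' < S.arm x y d)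

/-- The clockwise order of darts at a vertex, cut open before the North port. -/
def Before (d d' : D) : Prop :=
  S.idx x y d < S.idx x y d' ∨ (S.idx x y d = S.idx x y d' ∧ S.PortBefore x y d d')

open Classical in
/-- The turn along a dart and at the following corner. -/
noncomputable def turnAt (d : D) : ℤ :=
  (if S.left x y d then 1 else -1) + 2 -
    (S.idx x y (S.next d) - S.idx x y (S.flip d) +
      4 * if S.Before x y (S.next d) (S.flip d) then 1 else 0)

/-- The total turn along a facial walk. -/
noncomputable def turn (d : D) : ℤ :=
  S.turnAt x y d + S.turnAt x y (S.next d) + S.turnAt x y (S.next (S.next d))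

theorem turn_next (d : D) : S.turn x y (S.next d) = S.turn x y d := by
  simp only [turn, next_next_next]; ring

/-- The edges of the triangle to the left of the dart do not cross. -/
def Simple (d : D) : Prop :=
  LShape.simple (S.tail d) (S.tail (S.next d)) (S.tail (S.next (S.next d)))
    (S.up x d) (S.up x (S.next d)) (S.up x (S.next (S.next d)))
    (S.up y d) (S.up y (S.next d)) (S.up y (S.next (S.next d))) = true

/-- The contribution of a dart to the winding number. -/
def wind (A B : V → Bool) (d : D) : ℤ :=
  LShape.wind (S.tail d) (A (S.vtx d)) (A (S.far d)) (B (S.vtx d)) (B (S.far d))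

/-- The winding number of the face to the left of a dart. -/
def winding (A B : V → Bool) (d : D) : ℤ :=
  S.wind A B d + S.wind A B (S.next d) + S.wind A B (S.next (S.next d))

theorem winding_next (A B : V → Bool) (d : D) : S.winding A B (S.next d) = S.winding A B d := by
  simp only [winding, next_next_next]; ring

theorem wind_flip (A B : V → Bool) (d : D) : S.wind A B (S.flip d) = - S.wind A B d := by
  simp only [wind, LShape.wind, S.tail_flip, vtx_flip, far_flip]
  cases S.tail d <;> simp

theorem winding_eq (A B : V → Bool) (d : D) : S.winding A B d =
    LShape.winding (S.tail d) (S.tail (S.next d)) (S.tail (S.next (S.next d)))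
      (A (S.vtx d)) (A (S.far d)) (A (S.far (S.next d)))
      (B (S.vtx d)) (B (S.far d)) (B (S.far (S.next d))) := by
  simp [winding, wind, LShape.winding]

theorem winding_reverse (A B : V → Bool) (d : D) :
    S.reverse.winding B (fun v => !A v) d = S.winding A B d := by
  simp [winding_eq, LShape.winding_eq_horizontal (S.tail d)]

variable {x y}

theorem up_flip (hx : Function.Injective x) (d : D) : S.up x (S.flip d) = !S.up x d := by
  have : x (S.far d) ≠ x (S.vtx d) := fun h => S.far_ne d (hx h)
  simp only [up, vtx_flip, far_flip]
  rw [← decide_not, decide_eq_decide, not_lt]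
  exact ⟨le_of_lt, fun h => lt_of_le_of_ne h this⟩

theorem acyclic_up (hx : Function.Injective x) (d : D) :
    LShape.acyclic (S.up x d) (S.up x (S.next d)) (S.up x (S.next (S.next d))) = true := by
  have h₁ : x (S.far d) ≠ x (S.vtx d) := fun h => S.far_ne d (hx h)
  have h₂ : x (S.far (S.next d)) ≠ x (S.vtx d) := fun h => S.far_next_ne d (hx h)
  have h₃ : x (S.far (S.next d)) ≠ x (S.far d) := fun h => S.far_next_ne_far d (hx h)
  simp only [LShape.acyclic, up, far_next_next, vtx_next, Bool.not_eq_true', Bool.and_eq_false_iff,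
    beq_eq_false_iff_ne, ne_eq, decide_eq_decide]
  by_contra! h
  rcases lt_or_gt_of_ne h₁ with h₁ | h₁ <;> rcases lt_or_gt_of_ne h₂ with h₂ | h₂ <;>
    rcases lt_or_gt_of_ne h₃ with h₃ | h₃ <;> grind

/-- An indicator that is monotone with respect to a coordinate. -/
def Upper (x : V → ℝ) (A : V → Bool) : Prop := ∀ u v, x u ≤ x v → A u = true → A v = true

theorem mono_up {A : V → Bool} (hA : Upper x A) (d : D) :
    LShape.mono (S.up x d) (A (S.vtx d)) (A (S.far d)) = true := by
  have h₁ := hA (S.vtx d) (S.far d)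
  have h₂ := hA (S.far d) (S.vtx d)
  simp only [LShape.mono, up, decide_eq_true_eq]
  split_ifs with h
  · have := h₁ h.le; grind
  · have := h₂ (not_lt.1 h); grind

theorem mono₃_up {A : V → Bool} (hA : Upper x A) (d : D) :
    LShape.mono₃ (S.up x d) (S.up x (S.next d)) (S.up x (S.next (S.next d)))
      (A (S.vtx d)) (A (S.far d)) (A (S.far (S.next d))) = true := by
  have h₁ := S.mono_up hA d
  have h₂ := S.mono_up hA (S.next d)
  have h₃ := S.mono_up hA (S.next (S.next d))
  simp only [vtx_next, far_next_next] at h₂ h₃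
  simp [LShape.mono₃, h₁, h₂, h₃]

/-- Arms of the same direction are compared through their far ends, so lengths matter only through
the order of coordinates. -/
theorem abs_sub_lt_abs_sub_iff {p q r : ℝ} (hqr : q ≠ r)
    (h : decide (p < q) = decide (p < r)) :
    (|q - p| < |r - p| ↔ (decide (p < q) == decide (q < r)) = true) ∧
    (|r - p| < |q - p| ↔ (decide (p < q) == decide (q < r)) = false) := by
  rw [decide_eq_decide] at h
  by_cases hq : p < q
  · rw [abs_of_pos (sub_pos.2 hq), abs_of_pos (sub_pos.2 (h.1 hq))]
    rcases lt_or_gt_of_ne hqr with h' | h' <;> simp [hq, h', h'.le]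
  · have hr := not_lt.1 (mt h.2 hq)
    rw [abs_of_nonpos (sub_nonpos.2 (not_lt.1 hq)), abs_of_nonpos (sub_nonpos.2 hr)]
    rcases lt_or_gt_of_ne hqr with h' | h' <;> simp [hq, h', h'.le]

theorem portBefore_iff (d d' : D) (hv : S.vtx d = S.vtx d')
    (hx : x (S.far d) ≠ x (S.far d')) (hy : y (S.far d) ≠ y (S.far d'))
    (hi : S.idx x y d = S.idx x y d') :
    S.PortBefore x y d d' ↔ LShape.portBefore (S.tail d) (S.up x d) (S.up y d)
      (S.tail d') (S.up x d') (S.up y d') (decide (x (S.far d) < x (S.far d')))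
      (decide (y (S.far d) < y (S.far d'))) = true := by
  have key : (S.arm x y d < S.arm x y d' ↔ LShape.shorter (S.tail d) (S.up x d) (S.up y d)
      (decide (x (S.far d) < x (S.far d'))) (decide (y (S.far d) < y (S.far d'))) = true) ∧
      (S.arm x y d' < S.arm x y d ↔ LShape.shorter (S.tail d) (S.up x d) (S.up y d)
      (decide (x (S.far d) < x (S.far d'))) (decide (y (S.far d) < y (S.far d'))) = false) := by
    -- Equal port indices mean ends of the same kind with arms in the same direction.
    have ht : S.tail d = S.tail d' ∧ (S.tail d = true → S.up y d = S.up y d') ∧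
        (S.tail d = false → S.up x d = S.up x d') := by
      revert hi
      simp only [idx]
      generalize S.tail d = t; generalize S.tail d' = t'
      generalize S.up x d = a; generalize S.up x d' = a'
      generalize S.up y d = b; generalize S.up y d' = b'
      revert t t' a a' b b'; decide
    obtain ⟨ht, h₁, h₂⟩ := ht
    simp only [arm, LShape.shorter, ← ht, ← hv]
    cases htd : S.tail d
    · have := h₂ htd
      simp only [up, ← hv] at this
      simpa [up] using abs_sub_lt_abs_sub_iff hx this
    · have := h₁ htd
      simp only [up, ← hv] at this
      simpa [up] using abs_sub_lt_abs_sub_iff hy this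
  simp only [PortBefore, LShape.portBefore, key.1, key.2, left, Bool.or_eq_true, Bool.and_eq_true,
    Bool.not_eq_true', and_assoc, or_assoc]

theorem before_iff (d d' : D) (hv : S.vtx d = S.vtx d')
    (hx : x (S.far d) ≠ x (S.far d')) (hy : y (S.far d) ≠ y (S.far d')) :
    S.Before x y d d' ↔ LShape.before (S.tail d) (S.up x d) (S.up y d)
      (S.tail d') (S.up x d') (S.up y d') (decide (x (S.far d) < x (S.far d')))
      (decide (y (S.far d) < y (S.far d'))) = true := by
  have h := S.portBefore_iff (x := x) (y := y) d d' hv hx hy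
  simp only [Before, LShape.before, Bool.or_eq_true, Bool.and_eq_true, decide_eq_true_eq]
  constructor
  · rintro (h' | ⟨h', h''⟩)
    · exact Or.inl h'
    · exact Or.inr ⟨h', (h h').1 h''⟩
  · rintro (h' | ⟨h', h''⟩)
    · exact Or.inl h'
    · exact Or.inr ⟨h', (h h').2 h''⟩

/-- The far ends of the two darts at a corner are joined by the third edge of the triangle. Hence
comparisons along edges determine the turn. -/
theorem turnAt_eq (hx : Function.Injective x) (hy : Function.Injective y) (d : D) :
    S.turnAt x y d = LShape.turnAt (S.tail d) (S.tail (S.next d))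
      (S.up x d) (S.up x (S.next d)) (S.up x (S.next (S.next d)))
      (S.up y d) (S.up y (S.next d)) (S.up y (S.next (S.next d))) := by
  have hb := S.before_iff (x := x) (y := y) (S.next d) (S.flip d) (by simp)
    (fun h => S.far_next_ne d (by simpa using hx h)) (fun h => S.far_next_ne d (by simpa using hy h))
  have e : ∀ z : V → ℝ, S.up z (S.next (S.next d)) =
    decide (z (S.far (S.next d)) < z (S.far (S.flip d))) := fun z => by simp [up]
  rw [← e, ← e] at hb
  simp only [turnAt, LShape.turnAt, left, idx, S.tail_flip, S.up_flip hx, S.up_flip hy] at hb ⊢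
  congr 3
  simp only [LShape.ind, hb]

theorem turn_eq (hx : Function.Injective x) (hy : Function.Injective y) (d : D) :
    S.turn x y d = LShape.turn (S.tail d) (S.tail (S.next d)) (S.tail (S.next (S.next d)))
      (S.up x d) (S.up x (S.next d)) (S.up x (S.next (S.next d)))
      (S.up y d) (S.up y (S.next d)) (S.up y (S.next (S.next d))) := by
  simp only [turn, LShape.turn, S.turnAt_eq hx hy, next_next_next]

theorem up_neg (hx : Function.Injective x) (d : D) : S.up (-x) d = !S.up x d := by
  rw [← S.up_flip hx]; simp [up]

end Coordinates

end TriMap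

/-! ### Sort keys, and the tiling of the plane by the faces -/

namespace TriMap

variable {V D : Type*} (S : TriMap V D)

section Key

variable (x y : V → ℝ)

/-- A sort key for the clockwise order of darts at one port. -/
noncomputable def portKey (d : D) : ℤ ×ₗ ℝ :=
  toLex (if S.left x y d then (0, S.arm x y d) else (1, - S.arm x y d))

theorem portBefore_iff_portKey (d d' : D) :
    S.PortBefore x y d d' ↔ S.portKey x y d < S.portKey x y d' := by
  cases h : S.left x y d <;> cases h' : S.left x y d' <;>
    simp [PortBefore, portKey, h, h', Prod.Lex.toLex_lt_toLex]

/-- A sort key for the clockwise order of darts at a vertex. -/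
noncomputable def key (d : D) : ℤ ×ₗ (ℤ ×ₗ ℝ) := toLex (S.idx x y d, S.portKey x y d)

theorem before_iff_key (d d' : D) : S.Before x y d d' ↔ S.key x y d < S.key x y d' := by
  simp [Before, key, portBefore_iff_portKey, Prod.Lex.toLex_lt_toLex]

variable {x y}

theorem eq_of_abs_sub_eq {p q r : ℝ} (h : |q - p| = |r - p|)
    (hs : decide (p < q) = decide (p < r)) : q = r := by
  by_contra hqr
  have := abs_sub_lt_abs_sub_iff hqr hs
  rw [h] at this
  simp only [lt_self_iff_false, false_iff] at this
  grind

/-- Within one port the arm length determines a coordinate of the far end, hence by injectivity the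
far end itself. -/
theorem eq_of_key_eq (hx : Function.Injective x) (hy : Function.Injective y) {d d' : D}
    (hv : S.vtx d = S.vtx d') (h : S.key x y d = S.key x y d') : d = d' := by
  have h₁ : S.idx x y d = S.idx x y d' := congrArg (fun z => (ofLex z).1) h
  have h₂ : S.portKey x y d = S.portKey x y d' := congrArg (fun z => (ofLex z).2) h
  have ha : S.arm x y d = S.arm x y d' := by
    cases h : S.left x y d <;> cases h' : S.left x y d' <;>
      simp [portKey, h, h'] at h₂ <;> exact h₂
  have ht : S.tail d = S.tail d' ∧ (S.tail d = true → S.up y d = S.up y d') ∧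
      (S.tail d = false → S.up x d = S.up x d') := by
    revert h₁
    simp only [idx]
    generalize S.tail d = t; generalize S.tail d' = t'
    generalize S.up x d = a; generalize S.up x d' = a'
    generalize S.up y d = b; generalize S.up y d' = b'
    revert t t' a a' b b'; decide
  obtain ⟨ht, hu, hu'⟩ := ht
  refine S.ext d d' hv ?_ ht
  simp only [arm, ← ht, ← hv] at ha
  cases htd : S.tail d
  · have := hu' htd
    simp only [up, ← hv] at this
    exact hx (eq_of_abs_sub_eq (by simpa [htd] using ha) this)
  · have := hu htd
    simp only [up, ← hv] at this
    exact hy (eq_of_abs_sub_eq (by simpa [htd] using ha) this)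

end Key

/-- The faces are drawn without self-crossings, and exactly one of them, with its three darts,
is drawn clockwise. -/
structure Good [Fintype D] (x y : V → ℝ) : Prop where
  x_inj : Function.Injective x
  y_inj : Function.Injective y
  simple : ∀ d, S.Simple x y d
  card : (Finset.univ.filter (fun d => S.turn x y d = -4)).card = 3

/-- The indicator of the face to the left of a dart, the clockwise face being the outside of its
triangle. -/
noncomputable def chi (x y : V → ℝ) (A B : V → Bool) (d : D) : ℤ :=
  S.winding A B d + if S.turn x y d = -4 then 1 else 0

theorem chi_next (x y : V → ℝ) (A B : V → Bool) (d : D) :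
    S.chi x y A B (S.next d) = S.chi x y A B d := by
  simp only [chi, winding_next, turn_next]

theorem simple_reverse {x y : V → ℝ} (hy : Function.Injective y) {d : D} (h : S.Simple x y d) :
    S.reverse.Simple (-y) x d := by
  have e : ∀ z : V → ℝ, S.reverse.up z = S.up z := fun _ => rfl
  simp only [Simple, reverse_tail, reverse_next, e, S.up_neg hy] at h ⊢
  revert h
  generalize S.tail d = t; generalize S.tail (S.next d) = t'
  generalize S.tail (S.next (S.next d)) = t''
  generalize S.up x d = a; generalize S.up x (S.next d) = a'
  generalize S.up x (S.next (S.next d)) = a''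
  generalize S.up y d = b; generalize S.up y (S.next d) = b'
  generalize S.up y (S.next (S.next d)) = b''
  revert t t' t'' a a' a'' b b' b''
  decide +kernel

theorem turn_reverse {x y : V → ℝ} (hx : Function.Injective x) (hy : Function.Injective y) {d : D}
    (h : S.Simple x y d) : S.reverse.turn (-y) x d = S.turn x y d := by
  have hy' : Function.Injective (-y) := neg_injective.comp hy
  have e : ∀ z : V → ℝ, S.reverse.up z = S.up z := fun _ => rfl
  rw [turn_eq _ hy' hx, turn_eq _ hx hy]
  simp only [reverse_tail, reverse_next, e, S.up_neg hy]
  exact LShape.turn_rotate _ _ _ _ _ _ _ _ _ (S.acyclic_up hx d) (S.acyclic_up hy d) h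

theorem sum_wind [Fintype D] (A B : V → Bool) : ∑ d, S.wind A B d = 0 := by
  have h : ∑ d, S.wind A B (S.flip d) = ∑ d, S.wind A B d :=
    Equiv.sum_comp (⟨S.flip, S.flip, S.flip_flip, S.flip_flip⟩ : D ≃ D) _
  simp only [wind_flip, Finset.sum_neg_distrib] at h
  omega

theorem sum_next [Fintype D] {M : Type*} [AddCommMonoid M] (f : D → M) :
    ∑ d, f (S.next d) = ∑ d, f d :=
  Equiv.sum_comp ((⟨S.flip, S.flip, S.flip_flip, S.flip_flip⟩ : D ≃ D).trans S.rot) f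

theorem sum_winding [Fintype D] (A B : V → Bool) : ∑ d, S.winding A B d = 0 := by
  simp only [winding, Finset.sum_add_distrib]
  rw [S.sum_next (fun d => S.wind A B (S.next d)), S.sum_next, S.sum_wind]
  rfl

namespace Good

variable {S} [Fintype D] {x y : V → ℝ} (h : S.Good x y)
include h

/-- This quarter-turn symmetry transfers results on vertical segments to horizontal ones and
permutes the four directions. -/
theorem reverse : S.reverse.Good (-y) x where
  x_inj := neg_injective.comp h.y_inj
  y_inj := h.x_inj
  simple d := S.simple_reverse h.y_inj (h.simple d)
  card := by
    simp only [fun d => S.turn_reverse h.x_inj h.y_inj (h.simple d)]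
    exact h.card

theorem turn (d : D) : S.turn x y d = 4 ∨ S.turn x y d = -4 := by
  rw [S.turn_eq h.x_inj h.y_inj]
  exact LShape.turn_eq _ _ _ _ _ _ _ _ _ (S.acyclic_up h.x_inj d) (S.acyclic_up h.y_inj d)
    (h.simple d)

theorem winding {A B : V → Bool} (hA : Upper x A) (hB : Upper y B) (d : D) :
    S.winding A B d = 0 ∨ 4 * S.winding A B d = S.turn x y d := by
  rw [S.turn_eq h.x_inj h.y_inj, winding_eq]
  exact LShape.winding_of_turn _ _ _ _ _ _ _ _ _ (S.acyclic_up h.x_inj d)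
    (S.acyclic_up h.y_inj d) (h.simple d) _ _ _ (S.mono₃_up hA d) _ _ _ (S.mono₃_up hB d)

/-- The winding number is 0 or 1 for a counterclockwise face and 0 or -1 for the clockwise one,
where it is shifted by one. -/
theorem chi_eq {A B : V → Bool} (hA : Upper x A) (hB : Upper y B) (d : D) :
    S.chi x y A B d = 0 ∨ S.chi x y A B d = 1 := by
  have h₁ := h.winding hA hB d
  have h₂ := h.turn d
  simp only [chi]
  split_ifs <;> omega

/-- Winding numbers cancel in total, which leaves the three darts of the clockwise face. Every face
is counted at its three darts, so exactly one face contains each point. -/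
theorem sum_chi (A B : V → Bool) : ∑ d, S.chi x y A B d = 3 := by
  simp only [chi, Finset.sum_add_distrib, S.sum_winding, Finset.sum_boole, h.card]
  rfl

/-- No two faces overlap. -/
theorem eq_of_chi_eq_one {A B : V → Bool} (hA : Upper x A) (hB : Upper y B) {d d' : D}
    (hd : S.chi x y A B d = 1) (hd' : S.chi x y A B d' = 1) :
    d' = d ∨ d' = S.next d ∨ d' = S.next (S.next d) := by
  classical
  by_contra! hne
  obtain ⟨h₁, h₂, h₃⟩ := hne
  have h₄ := (S.next_ne d).symm
  have h₅ := (S.next_next_ne d).symm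
  have h₆ := (S.next_ne (S.next d)).symm
  -- A dart outside the triangle of `d` would be a fourth one with value 1, while the total is 3.
  have hs : ∑ e ∈ ({d', d, S.next d, S.next (S.next d)} : Finset D), S.chi x y A B e ≤
      ∑ e, S.chi x y A B e :=
    Finset.sum_le_sum_of_subset_of_nonneg (Finset.subset_univ _)
      (fun e _ _ => by rcases h.chi_eq hA hB e with h | h <;> omega)
  rw [h.sum_chi, Finset.sum_insert (by simp [h₁, h₂, h₃]), Finset.sum_insert (by simp [h₄, h₅]),
    Finset.sum_insert (by simpa using h₆), Finset.sum_singleton] at hs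
  simp only [S.chi_next, hd, hd'] at hs
  omega

theorem spike {d : D} (h₁ : S.tail d = false) (h₂ : S.tail (S.next d) = true)
    (hi : S.idx x y (S.next d) = S.idx x y (S.flip d))
    (hb : S.PortBefore x y (S.next d) (S.flip d)) :
    S.turn x y d = -4 ∧ ∀ A B, Upper x A → Upper y B → B (S.vtx d) ≠ B (S.far d) →
      B (S.far (S.next d)) ≠ B (S.far d) → S.winding A B d = 0 := by
  have e : ∀ z : V → ℝ, decide (z (S.far (S.next d)) < z (S.far (S.flip d))) =
    S.up z (S.next (S.next d)) := fun z => by simp [up]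
  rw [S.portBefore_iff _ _ (by simp) (fun h' => S.far_next_ne d (by simpa using h.x_inj h'))
    (fun h' => S.far_next_ne d (by simpa using h.y_inj h')) hi, e, e, S.up_flip h.x_inj,
    S.up_flip h.y_inj, S.tail_flip, h₁, h₂] at hb
  have hi' : (!S.up y d) = S.up y (S.next d) := by
    revert hi
    simp only [idx, S.up_flip h.x_inj, S.up_flip h.y_inj, S.tail_flip, h₁, h₂]
    generalize S.up y d = a; generalize S.up y (S.next d) = b
    generalize S.up x d = a'; generalize S.up x (S.next d) = b'
    revert a b a' b'; decide
  have hs := h.simple d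
  rw [Simple, h₁, h₂] at hs
  have := LShape.turn_of_spike _ _ _ _ _ _ _ (S.acyclic_up h.x_inj d) (S.acyclic_up h.y_inj d)
    hs hi' hb
  rw [S.turn_eq h.x_inj h.y_inj, h₁, h₂]
  refine ⟨this.1, fun A B hA hB hb₁ hb₂ => ?_⟩
  rw [winding_eq, h₁, h₂]
  exact this.2 _ _ _ (S.mono₃_up hA d) _ _ _ (S.mono₃_up hB d) hb₁ hb₂

end Good

end TriMap

/-! ### Absence of crossings between vertical and horizontal segments -/

namespace TriMap

variable {V D : Type*} {S : TriMap V D}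

/-- The points at or beyond `u`. -/
noncomputable def atLeast (x : V → ℝ) (u : V) (v : V) : Bool := decide (x u ≤ x v)

/-- The points beyond `a`. -/
noncomputable def beyond (x : V → ℝ) (a : ℝ) (v : V) : Bool := decide (a < x v)

theorem upper_atLeast (x : V → ℝ) (u : V) : Upper x (atLeast x u) := fun v w h h' => by
  simp only [atLeast, decide_eq_true_eq] at h' ⊢; exact h'.trans h

theorem upper_beyond (x : V → ℝ) (a : ℝ) : Upper x (beyond x a) := fun v w h h' => by
  simp only [beyond, decide_eq_true_eq] at h' ⊢; exact h'.trans_le h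

/-- The points immediately to the left of an upward (`b = false`) or downward (`b = true`) vertical
segment at `u`. -/
noncomputable def leftSide (b : Bool) (x : V → ℝ) (u : V) : V → Bool :=
  match b with
  | true => beyond x (x u)
  | false => atLeast x u

theorem upper_leftSide (b : Bool) (x : V → ℝ) (u : V) : Upper x (leftSide b x u) := by
  cases b
  · exact upper_atLeast _ _
  · exact upper_beyond _ _

theorem reverse_reverse : S.reverse.reverse = S := by
  cases S; simp [reverse]

/-- Upward or downward darts at a vertex across a common horizontal line use the same port. -/
theorem idx_eq_of_cross {x y : V → ℝ} {B : V → Bool} (hB : Upper y B) {d d' : D}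
    (ht : S.tail d = true) (ht' : S.tail d' = true) (hv : S.vtx d' = S.vtx d)
    (hd : B (S.far d) ≠ B (S.vtx d)) (hd' : B (S.far d') ≠ B (S.vtx d)) :
    S.idx x y d = S.idx x y d' := by
  have h₁ := S.mono_up hB d
  have h₂ := S.mono_up hB d'
  rw [hv] at h₂
  revert h₁ h₂ hd hd'
  simp only [idx, ht, ht']
  generalize S.up y d = a; generalize S.up y d' = b
  generalize S.up x d = a'; generalize S.up x d' = b'
  generalize B (S.far d) = c; generalize B (S.far d') = c'; generalize B (S.vtx d) = c''
  revert a b a' b' c c' c''; decide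

namespace Good

variable [Fintype D] {x y : V → ℝ} (h : S.Good x y)
include h

/-- The face to the left of the clockwise first of the vertical segments at a vertex that meet a
horizontal line contains the points immediately to their left. -/
theorem chi_eq_one_of_first {B : V → Bool} (hB : Upper y B) {d : D} (ht : S.tail d = true)
    (hd : B (S.far d) ≠ B (S.vtx d))
    (hmin : ∀ d', S.vtx d' = S.vtx d → S.tail d' = true → B (S.far d') ≠ B (S.vtx d) →
      ¬ S.PortBefore x y d' d) :
    S.chi x y (leftSide (B (S.vtx d)) x (S.vtx d)) B d = 1 := by
  set u := S.vtx d with hu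
  set c := S.next (S.next d) with hc
  have hcd : S.next c = d := S.next_next_next d
  have hcfar : S.far c = u := S.far_next_next d
  have hcv : S.vtx c = S.far (S.next d) := S.vtx_next _
  have hA := upper_leftSide (B u) x u
  -- The dart `c` precedes `d` on the facial walk. If its vertical segment is also at `u` and meets
  -- the line, then `d` being first makes the corner a spike.
  by_cases hcc : S.tail c = false ∧ B (S.vtx c) ≠ B u
  · obtain ⟨hc₁, hc₂⟩ := hcc
    have hft : S.tail (S.flip c) = true := by rw [S.tail_flip, hc₁]; rfl
    have hfv : S.vtx (S.flip c) = u := hcfar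
    have hidx : S.idx x y d = S.idx x y (S.flip c) :=
      idx_eq_of_cross hB ht hft hfv hd (by simpa using hc₂)
    have hb : S.PortBefore x y d (S.flip c) := by
      have h₁ := hmin (S.flip c) hfv hft (by simpa using hc₂)
      rw [portBefore_iff_portKey] at h₁ ⊢
      refine lt_of_le_of_ne (not_lt.1 h₁) fun he => ?_
      have := S.eq_of_key_eq h.x_inj h.y_inj hfv.symm (by rw [key, key, hidx, he])
      have h₂ := congrArg S.far this
      rw [far_flip, hcv] at h₂
      exact S.far_next_ne_far d h₂.symm
    rw [← hcd] at hidx hb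
    have hs := h.spike hc₁ (by rw [hcd]; exact ht) hidx hb
    rw [hcd, hcfar] at hs
    have hw := hs.2 _ _ hA hB hc₂ hd
    rw [← hcd, chi_next, chi, hw, hs.1]
    rfl
  -- Otherwise `d` is the only edge of the triangle with a vertical segment at `u` meeting the line,
  -- so the winding number on its left is one more than on its right.
  · have hw : S.winding (leftSide (B u) x u) B d -
        S.winding (leftSide (!B u) x u) B d = 1 := by
      have e : ∀ v, v ≠ u → atLeast x u v = beyond x (x u) v := fun v hv => by
        have : x u ≠ x v := fun h' => hv (h.x_inj h').symm
        simp only [atLeast, beyond, decide_eq_decide]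
        exact ⟨fun h' => lt_of_le_of_ne h' this, le_of_lt⟩
      have e₁ : atLeast x u u = true := by simp [atLeast]
      have e₂ : beyond x (x u) u = false := by simp [beyond]
      have e₃ := e _ (S.far_ne d)
      have e₄ := e _ (S.far_next_ne d)
      rw [winding_eq, winding_eq, ht, ← hu]
      rw [hcv] at hcc
      rw [← hc]
      revert hcc hd
      cases hBu : B u
      · simp only [leftSide, Bool.not_false, e₁, e₂, e₃, e₄]
        generalize S.tail c = t; generalize B (S.far d) = b; generalize B (S.far (S.next d)) = b'
        generalize beyond x (x u) (S.far d) = a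
        generalize beyond x (x u) (S.far (S.next d)) = a'
        generalize S.tail (S.next d) = t'
        revert t b b' a a' t'; decide
      · simp only [leftSide, Bool.not_true, e₁, e₂, e₃, e₄]
        generalize S.tail c = t; generalize B (S.far d) = b; generalize B (S.far (S.next d)) = b'
        generalize beyond x (x u) (S.far d) = a
        generalize beyond x (x u) (S.far (S.next d)) = a'
        generalize S.tail (S.next d) = t'
        revert t b b' a a' t'; decide
    have hA' : Upper x (leftSide (!B u) x u) := upper_leftSide _ _ _
    -- Both winding numbers are 0 or a quarter of the turn. As they differ by one, the left one is 1
    -- for turn 4 and 0 for turn -4.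
    have h₁ := h.winding hA hB d
    have h₂ := h.winding hA' hB d
    have h₃ := h.turn d
    simp only [chi]
    split_ifs <;> omega

/-- Among the vertical segments at a vertex that meet a horizontal line there is one whose left
face contains the points immediately to the left of these segments. -/
theorem exists_first {B : V → Bool} (hB : Upper y B) {d : D} (ht : S.tail d = true)
    (hd : B (S.far d) ≠ B (S.vtx d)) :
    ∃ c, S.vtx c = S.vtx d ∧ S.tail c = true ∧ B (S.far c) ≠ B (S.vtx c) ∧
      ¬ S.PortBefore x y d c ∧
      S.chi x y (leftSide (B (S.vtx d)) x (S.vtx d)) B c = 1 := by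
  classical
  obtain ⟨c, hc, hmin⟩ := Finset.exists_min_image
    (Finset.univ.filter fun c => S.vtx c = S.vtx d ∧ S.tail c = true ∧ B (S.far c) ≠ B (S.vtx d))
    (S.portKey x y) ⟨d, by simp [ht, hd]⟩
  simp only [Finset.mem_filter, Finset.mem_univ, true_and] at hc hmin
  obtain ⟨hc₁, hc₂, hc₃⟩ := hc
  refine ⟨c, hc₁, hc₂, by rwa [hc₁], ?_, ?_⟩
  · rw [portBefore_iff_portKey, not_lt]
    exact hmin d ⟨rfl, ht, hd⟩
  · rw [← hc₁] at hc₃ ⊢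
    refine h.chi_eq_one_of_first hB hc₂ hc₃ fun d' h₁ h₂ h₃ => ?_
    rw [portBefore_iff_portKey, not_lt]
    exact hmin d' ⟨h₁.trans hc₁, h₂, by rwa [← hc₁]⟩

/-- The crossing would be at `(x u, y w)`. The point just south-west of it lies in the left face of
the first vertical segment at `u` passing the height of `w`, and in the left face of the first
horizontal segment at `w` passing `u`. Faces do not overlap, so both darts lie on one triangle, and
each of their three relative positions is impossible. -/
theorem no_cross_north_west {e f : D} (he : S.tail e = true) (hf : S.tail f = false)
    (h₁ : y (S.vtx e) < y (S.vtx f)) (h₂ : y (S.vtx f) < y (S.far e))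
    (h₃ : x (S.far f) < x (S.vtx e)) (h₄ : x (S.vtx e) < x (S.vtx f)) : False := by
  set u := S.vtx e with hu
  set w := S.vtx f with hw
  have b₁ : atLeast y w u = false := by simpa [atLeast] using h₁
  have b₂ : atLeast y w (S.far e) = true := by simpa [atLeast] using h₂.le
  obtain ⟨c, hc, hct, hcB, hcmin, hcχ⟩ := h.exists_first (upper_atLeast y w) he
    (by rw [b₁, b₂]; decide)
  rw [← hu, b₁] at hcχ
  rw [hc, ← hu, b₁] at hcB
  simp only [leftSide] at hcχ
  -- A dart from `u` to `w` bends right with a shorter arm than `e`, so it would come after `e`.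
  have hcw : S.far c ≠ w := by
    intro hcw
    apply hcmin
    have hup : S.up y c = true := by simp [up, hc, ← hu, hcw, h₁]
    have hux : S.up x c = true := by simp [up, hc, ← hu, hcw, h₄]
    have hue : S.up y e = true := by simpa [up] using h₁.trans h₂
    have hlc : S.left x y c = false := by rw [left, hct, hup, hux]; rfl
    have harm : S.arm x y c < S.arm x y e := by
      simp only [arm, hct, he, if_true, hcw, hc, ← hu]
      rw [abs_of_pos (by linarith), abs_of_pos (by linarith)]
      linarith
    cases hle : S.left x y e
    · exact Or.inr (Or.inr ⟨hle, hlc, harm⟩)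
    · exact Or.inr (Or.inl ⟨hle, hlc⟩)
  -- Three quarter turns take `(x, y)` to `(y, -x)`, and a segment going west to one going north.
  have h' := h.reverse.reverse.reverse
  rw [neg_neg, reverse_reverse] at h'
  have a₁ : (!atLeast x u w) = false := by simpa [atLeast] using h₄.le
  have a₂ : (!atLeast x u (S.far f)) = true := by simpa [atLeast] using h₃
  have hUp : Upper (-x) (fun v => !atLeast x u v) := fun v v' hv hv' => by
    simp only [atLeast, Bool.not_eq_true', decide_eq_false_iff_not, not_le, Pi.neg_apply] at *
    linarith
  obtain ⟨g, hg, -, hgB, -, hgχ⟩ := h'.exists_first hUp (d := f) (by simp [hf])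
    (by simp only [reverse_far, reverse_vtx]; rw [a₂, ← hw, a₁]; decide)
  simp only [reverse_far, reverse_vtx] at hg hgB hgχ
  rw [← hw, a₁] at hgχ
  rw [hg, ← hw, a₁] at hgB
  simp only [leftSide] at hgχ
  have hgu : S.far g ≠ u := by
    rintro hgu
    rw [hgu] at hgB
    simp [atLeast] at hgB
  have hχ : S.chi x y (atLeast x u) (atLeast y w) g = 1 := by
    rw [← hgχ, chi, chi, winding_reverse, ← S.reverse.turn_reverse h'.x_inj h'.y_inj (h'.simple g),
      neg_neg, reverse_reverse]
  rcases h.eq_of_chi_eq_one (upper_atLeast _ _) (upper_atLeast _ _) hcχ hχ with rfl | rfl | rfl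
  · exact h₄.ne (congrArg x (hc.symm.trans hg))
  · exact hcw (by rw [hw, ← hg, vtx_next])
  · exact hgu (by rw [far_next_next, hc])

/-- No vertical segment properly crosses a horizontal segment. -/
theorem no_cross {e f : D} (he : S.tail e = true) (hf : S.tail f = false)
    (hy : y (S.vtx e) < y (S.vtx f) ∧ y (S.vtx f) < y (S.far e) ∨
      y (S.far e) < y (S.vtx f) ∧ y (S.vtx f) < y (S.vtx e))
    (hx : x (S.far f) < x (S.vtx e) ∧ x (S.vtx e) < x (S.vtx f) ∨
      x (S.vtx f) < x (S.vtx e) ∧ x (S.vtx e) < x (S.far f)) : False := by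
  -- Quarter turns bring every crossing into the north-west position; an odd number of them
  -- exchanges the roles of `e` and `f`.
  rcases hy with ⟨h₁, h₂⟩ | ⟨h₁, h₂⟩ <;> rcases hx with ⟨h₃, h₄⟩ | ⟨h₃, h₄⟩
  · exact h.no_cross_north_west he hf h₁ h₂ h₃ h₄
  · exact h.reverse.no_cross_north_west (e := f) (f := e) (by simp [hf]) (by simp [he])
      (by simpa using h₃) (by simpa using h₄) (by simpa using h₂) (by simpa using h₁)
  · exact h.reverse.reverse.reverse.no_cross_north_west (e := f) (f := e) (by simp [hf])
      (by simp [he]) (by simpa using h₄) (by simpa using h₃) (by simpa using h₁)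
      (by simpa using h₂)
  · exact h.reverse.reverse.no_cross_north_west (e := e) (f := f) (by simp [he]) (by simp [hf])
      (by simpa using h₂) (by simpa using h₁) (by simpa using h₄) (by simpa using h₃)

end Good

end TriMap

/-! ### Cyclic orders and descents -/

section Descents

variable {V D α : Type*} [LinearOrder α] {rot : Equiv.Perm D} {vtx : D → V} {key : D → α}
  (hv : ∀ d, vtx (rot d) = vtx d) (hne : ∀ d, rot d ≠ d)
  (hk : ∀ d d', vtx d = vtx d' → key d = key d' → d = d')
include hv hne hk

theorem key_rot_lt_or_gt (d : D) : key (rot d) < key d ∨ key d < key (rot d) :=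
  lt_or_gt_of_ne fun h => hne d (hk _ _ (hv d) h)

variable [Finite D]

/-- A rotation that respects a cyclic order has exactly one descent around every vertex. -/
theorem existsUnique_descent
    (h : ∀ d d', vtx d' = vtx d → ¬ ((key d < key d' ∧ key d' < key (rot d)) ∨
      (key d' < key (rot d) ∧ key (rot d) < key d) ∨ (key (rot d) < key d ∧ key d < key d')))
    (d₀ : D) : ∃! d, vtx d = vtx d₀ ∧ key (rot d) < key d := by
  classical
  have := Fintype.ofFinite D
  obtain ⟨m, hm, hmax⟩ := Finset.exists_max_image (Finset.univ.filter fun d => vtx d = vtx d₀) key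
    ⟨d₀, by simp⟩
  simp only [Finset.mem_filter, Finset.mem_univ, true_and] at hm hmax
  refine ⟨m, ⟨hm, ?_⟩, ?_⟩
  · rcases key_rot_lt_or_gt hv hne hk m with h' | h'
    · exact h'
    · exact absurd (hmax (rot m) (by rw [hv, hm])) (not_le.2 h')
  · rintro d ⟨hd, hd'⟩
    by_contra hdm
    rcases lt_or_eq_of_le (hmax d hd) with h' | h'
    · exact h d m (hm.trans hd.symm) (Or.inr (Or.inr ⟨hd', h'⟩))
    · exact hdm (hk _ _ (hd.trans hm.symm) h')

/-- A rotation with at most one descent around every vertex respects the cyclic order. -/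
theorem not_between_of_descent_unique
    (h : ∀ d d', vtx d = vtx d' → key (rot d) < key d → key (rot d') < key d' → d = d')
    (d d' : D) (hd : vtx d' = vtx d) : ¬ ((key d < key d' ∧ key d' < key (rot d)) ∨
      (key d' < key (rot d) ∧ key (rot d) < key d) ∨ (key (rot d) < key d ∧ key d < key d')) := by
  classical
  have := Fintype.ofFinite D
  rintro (⟨h₁, h₂⟩ | ⟨h₁, h₂⟩ | ⟨h₁, h₂⟩)
  · set p := rot.symm d' with hp
    have hrp : rot p = d' := rot.apply_symm_apply d'
    have hpv : vtx p = vtx d := by rw [← hv, hrp, hd]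
    have hpd : p ≠ d := by rintro hpd; rw [← hrp, hpd] at h₂; exact lt_irrefl _ h₂
    set s := Finset.univ.filter fun z => vtx z = vtx d ∧ key d' ≤ key (rot z) with hs
    set t := Finset.univ.filter fun z => vtx z = vtx d ∧ key d' ≤ key z with ht
    -- The rotation climbs to the level of `d'` or above from the darts in `s \ t` and falls below
    -- it from those in `t \ s`. Since `rot` maps `s` onto `t`, there are equally many of both.
    have hst : s.card = t.card := by
      refine Finset.card_equiv rot fun z => ?_
      simp [hs, ht, hv]
    have hc := Finset.card_sdiff_comm hst
    have hds : d ∈ s \ t := by simp [hs, ht, h₁, h₂.le]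
    have hts : ∀ z ∈ t \ s, vtx z = vtx d ∧ key (rot z) < key z ∧ key (rot z) < key d' := by
      intro z hz
      simp only [hs, ht, Finset.mem_sdiff, Finset.mem_filter, Finset.mem_univ, true_and, not_and,
        not_le] at hz
      exact ⟨hz.1.1, (hz.2 hz.1.1).trans_le hz.1.2, hz.2 hz.1.1⟩
    -- If `p` is the descent, it ends at `d'` and not below, so nothing balances the climb at `d`.
    -- If `p` climbs, then `d` and `p` together require two descents.
    rcases key_rot_lt_or_gt hv hne hk p with h' | h'
    · have : t \ s = ∅ := by
        refine Finset.eq_empty_of_forall_notMem fun z hz => ?_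
        obtain ⟨hz₁, hz₂, hz₃⟩ := hts z hz
        rw [h z p (hz₁.trans hpv.symm) hz₂ h', hrp] at hz₃
        exact lt_irrefl _ hz₃
      rw [this, Finset.card_empty, Finset.card_eq_zero] at hc
      simp [hc] at hds
    · have hps : p ∈ s \ t := by
        rw [hrp] at h'
        simp [hs, ht, hpv, hrp, h']
      have h₃ : 1 < (s \ t).card := Finset.one_lt_card.2 ⟨p, hps, d, hds, hpd⟩
      rw [hc] at h₃
      obtain ⟨a, ha, b, hb, hab⟩ := Finset.one_lt_card.1 h₃
      exact hab (h a b ((hts a ha).1.trans (hts b hb).1.symm) (hts a ha).2.1 (hts b hb).2.1)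
  -- The predecessor of the minimum is a descent, hence equal to `d`.
  · obtain ⟨m, hm, hmin⟩ := Finset.exists_min_image (Finset.univ.filter fun z => vtx z = vtx d) key
      ⟨d, by simp⟩
    simp only [Finset.mem_filter, Finset.mem_univ, true_and] at hm hmin
    have hrp : rot (rot.symm m) = m := rot.apply_symm_apply m
    have hpv : vtx (rot.symm m) = vtx d := by rw [← hv, hrp, hm]
    have : rot.symm m = d := by
      refine h _ _ hpv ?_ h₂
      rcases key_rot_lt_or_gt hv hne hk (rot.symm m) with h' | h'
      · exact h'
      · rw [hrp] at h'
        exact absurd (hmin _ hpv) (not_le.2 h')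
    rw [← this, hrp] at h₁
    exact absurd (hmin d' hd) (not_le.2 h₁)
  -- The maximum is a descent, hence equal to `d`.
  · obtain ⟨m, hm, hmax⟩ := Finset.exists_max_image (Finset.univ.filter fun z => vtx z = vtx d) key
      ⟨d, by simp⟩
    simp only [Finset.mem_filter, Finset.mem_univ, true_and] at hm hmax
    have : m = d := by
      refine h _ _ hm ?_ h₁
      rcases key_rot_lt_or_gt hv hne hk m with h' | h'
      · exact h'
      · exact absurd (hmax (rot m) (by rw [hv, hm])) (not_le.2 h')
    rw [← this] at h₂
    exact absurd (hmax d' hd) (not_le.2 h₂)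

end Descents

/-! ### Total turn and Euler's formula -/

namespace TriMap

variable {V D : Type*} {S : TriMap V D}

theorem rot_ne (d : D) : S.rot d ≠ d := by
  intro h
  have h₁ : S.next (S.flip d) = d := by rw [next, S.flip_flip, h]
  have h₂ := S.far_next_ne (S.flip d)
  rw [h₁, vtx_flip] at h₂
  exact h₂ rfl

theorem left_flip {x y : V → ℝ} (hx : Function.Injective x) (hy : Function.Injective y) (d : D) :
    S.left x y (S.flip d) = !S.left x y d := by
  simp only [left, S.tail_flip, S.up_flip hx, S.up_flip hy]
  generalize S.tail d = t; generalize S.up x d = a; generalize S.up y d = b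
  revert t a b; decide

open Classical in
theorem card_descents [Fintype V] [Fintype D] {x y : V → ℝ}
    (hdart : ∀ v, ∃ d, S.vtx d = v)
    (h : ∀ d₀, ∃! d, S.vtx d = S.vtx d₀ ∧ S.Before x y (S.rot d) d) :
    (Finset.univ.filter fun d => S.Before x y (S.rot d) d).card = Fintype.card V := by
  rw [← Finset.card_univ]
  refine Finset.card_bij (fun d _ => S.vtx d) (fun _ _ => Finset.mem_univ _) ?_ ?_
  · intro a ha b hb hab
    simp only [Finset.mem_filter, Finset.mem_univ, true_and] at ha hb
    exact (h b).unique ⟨hab, ha⟩ ⟨rfl, hb⟩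
  · intro v _
    obtain ⟨d₀, rfl⟩ := hdart v
    obtain ⟨d, hd, -⟩ := h d₀
    exact ⟨d, by simpa using hd.2, hd.1⟩

theorem sum_flip [Fintype D] {M : Type*} [AddCommMonoid M] (f : D → M) :
    ∑ d, f (S.flip d) = ∑ d, f d :=
  Equiv.sum_comp (⟨S.flip, S.flip, S.flip_flip, S.flip_flip⟩ : D ≃ D) f

/-- Bends are opposite for the two darts of an edge, port indices cancel in the sum, and the
wrap-around term occurs at exactly one corner of every vertex. -/
theorem sum_turnAt [Fintype V] [Fintype D] {x y : V → ℝ} (hx : Function.Injective x)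
    (hy : Function.Injective y) (hdart : ∀ v, ∃ d, S.vtx d = v)
    (h : ∀ d₀, ∃! d, S.vtx d = S.vtx d₀ ∧ S.Before x y (S.rot d) d) :
    ∑ d, S.turnAt x y d = 2 * Fintype.card D - 4 * Fintype.card V := by
  classical
  have h₁ : ∑ d, (if S.left x y d then (1 : ℤ) else -1) = 0 := by
    have := S.sum_flip fun d => if S.left x y d then (1 : ℤ) else -1
    have e : ∀ d, (if S.left x y (S.flip d) then (1 : ℤ) else -1) =
        - if S.left x y d then (1 : ℤ) else -1 := fun d => by
      rw [S.left_flip hx hy]; cases S.left x y d <;> rfl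
    simp only [e, Finset.sum_neg_distrib] at this
    omega
  have h₂ : ∑ d, (if S.Before x y (S.next d) (S.flip d) then (1 : ℤ) else 0) = Fintype.card V := by
    rw [← card_descents hdart h,
      ← S.sum_flip fun d => if S.Before x y (S.next d) (S.flip d) then (1 : ℤ) else 0]
    simp only [next, S.flip_flip, Finset.sum_boole]

  simp only [turnAt, Finset.sum_sub_distrib, Finset.sum_add_distrib, ← Finset.mul_sum, h₁]
  rw [S.sum_next (S.idx x y), S.sum_flip (S.idx x y)]
  rw [Finset.sum_const, Finset.card_univ, nsmul_eq_mul, sub_self]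
  convert_to (0 : ℤ) + Fintype.card D * 2 - (0 + 4 * (Fintype.card V : ℤ)) = _
  · rw [← h₂]
  · ring

/-- Exactly one face is drawn clockwise, by Euler's formula. -/
theorem good_of_euler [Fintype V] [Fintype D] {x y : V → ℝ} (hx : Function.Injective x)
    (hy : Function.Injective y) (hdart : ∀ v, ∃ d, S.vtx d = v)
    (h : ∀ d₀, ∃! d, S.vtx d = S.vtx d₀ ∧ S.Before x y (S.rot d) d)
    (hs : ∀ d, S.Simple x y d) (he : Fintype.card D + 12 = 6 * Fintype.card V) : S.Good x y where
  x_inj := hx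
  y_inj := hy
  simple := hs
  card := by
    have h₁ : ∑ d, S.turn x y d = 3 * ∑ d, S.turnAt x y d := by
      simp only [turn, Finset.sum_add_distrib]
      rw [S.sum_next (fun d => S.turnAt x y (S.next d)), S.sum_next]
      ring
    have h₂ : ∀ d, S.turn x y d = 4 - 8 * if S.turn x y d = -4 then 1 else 0 := fun d => by
      have : S.turn x y d = 4 ∨ S.turn x y d = -4 := by
        rw [S.turn_eq hx hy]
        exact LShape.turn_eq _ _ _ _ _ _ _ _ _ (S.acyclic_up hx d) (S.acyclic_up hy d) (hs d)
      split_ifs <;> omega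
    -- With `k` clockwise darts this reads `4 |D| - 8 k = 6 |D| - 12 |V|`, and `|D| + 12 = 6 |V|`
    -- yields `k = 3`.
    rw [Finset.sum_congr rfl fun d _ => h₂ d, Finset.sum_sub_distrib, ← Finset.mul_sum,
      Finset.sum_boole, Finset.sum_const, Finset.card_univ, nsmul_eq_mul,
      sum_turnAt hx hy hdart h] at h₁
    omega

end TriMap

/-! ### The triangulated map of a plane digraph -/

instance : Finite EdgeSide := Finite.of_surjective
  (fun b : Bool => if b then EdgeSide.tail else EdgeSide.head)
  (by rintro (_ | _); exacts [⟨true, rfl⟩, ⟨false, rfl⟩])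

namespace PlaneDigraph

variable {V : Type*} {G : PlaneDigraph V}

theorem vertex_flip_ne (d : Dart G.edges) : d.flip.vertex ≠ d.vertex := by
  rcases d with ⟨⟨⟨u, v⟩, h⟩, s⟩
  have : u ≠ v := by rintro rfl; exact G.loopless u h
  cases s
  · exact this.symm
  · exact this

/-- The triangulated map of a triangulated plane digraph. -/
def triMap (hG : G.IsTriangulated) : TriMap V (Dart G.edges) where
  flip := Dart.flip
  rot := G.rot
  vtx := Dart.vertex
  tail d := match d.2 with
    | EdgeSide.tail => true
    | EdgeSide.head => false
  flip_flip := Dart.flip_flip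
  tail_flip := by rintro ⟨e, s⟩; cases s <;> rfl
  vtx_rot d := ((G.rot_sameCycle_iff _ _).1 (Equiv.Perm.SameCycle.refl _ _).apply_left)
  vtx_flip_ne := vertex_flip_ne
  rot_flip_iterate d := (hG d).2
  ext := by
    rintro ⟨⟨⟨u, v⟩, h⟩, s⟩ ⟨⟨⟨u', v'⟩, h'⟩, s'⟩ h₁ h₂ h₃
    cases s <;> cases s' <;> simp_all [Dart.vertex, Dart.flip]

variable (hG : G.IsTriangulated)

@[simp] theorem triMap_vtx (d : Dart G.edges) : (triMap hG).vtx d = d.vertex := rfl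
@[simp] theorem triMap_flip (d : Dart G.edges) : (triMap hG).flip d = d.flip := rfl
@[simp] theorem triMap_far (d : Dart G.edges) : (triMap hG).far d = d.flip.vertex := rfl
@[simp] theorem triMap_rot (d : Dart G.edges) : (triMap hG).rot d = G.rot d := rfl
variable {x y : V → ℝ}

open LDrawing

theorem index_port (hx : Function.Injective x) (hy : Function.Injective y) (d : Dart G.edges) :
    ((port x y d).index : ℤ) = (triMap hG).idx x y d := by
  have hne := vertex_flip_ne d
  rcases d with ⟨⟨⟨u, v⟩, h⟩, s⟩
  cases s
  · have hvu : y v ≠ y u := fun h => hne (hy h)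
    simp only [port, bend, point, Dart.edge, Dart.vertex, TriMap.idx, LShape.idx, triMap,
      TriMap.up, TriMap.far, Dart.flip, Prod.fst_sub, Prod.snd_sub, sub_pos, sub_self, lt_irrefl,
      sub_neg, if_false, if_true]
    rcases lt_or_gt_of_ne hvu with h' | h' <;> simp [h', h'.not_gt, Port.index]
  · have hvu : x u ≠ x v := fun h => hne (hx h)
    simp only [port, bend, point, Dart.edge, Dart.vertex, TriMap.idx, LShape.idx, triMap,
      TriMap.up, TriMap.far, Dart.flip, Prod.fst_sub, Prod.snd_sub, sub_pos, sub_self, lt_irrefl,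
      if_false, Bool.false_eq_true]
    rcases lt_or_gt_of_ne hvu with h' | h' <;> simp [h', h'.not_gt, Port.index]

theorem bendsLeft_iff (hx : Function.Injective x) (hy : Function.Injective y) (d : Dart G.edges) :
    BendsLeft x y d ↔ (triMap hG).left x y d = true := by
  have hne := vertex_flip_ne d
  have hx' : x d.flip.vertex ≠ x d.vertex := fun h => hne (hx h)
  have hy' : y d.flip.vertex ≠ y d.vertex := fun h => hne (hy h)
  rcases d with ⟨⟨⟨u, v⟩, h⟩, s⟩
  cases s <;>
  · simp only [Dart.flip, Dart.vertex] at hx' hy'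
    simp only [BendsLeft, bend, point, Dart.edge, Dart.vertex, TriMap.left, LShape.left, triMap,
      TriMap.up, TriMap.far, Dart.flip, Prod.fst_sub, Prod.snd_sub, sub_self]
    rcases lt_or_gt_of_ne hx' with h₁ | h₁ <;> rcases lt_or_gt_of_ne hy' with h₂ | h₂ <;>
      simp [h₁, h₂, h₁.le, h₁.not_gt, h₂.not_gt] <;> nlinarith

theorem armLength_eq (d : Dart G.edges) : armLength x y d = (triMap hG).arm x y d := by
  rcases d with ⟨⟨⟨u, v⟩, h⟩, s⟩
  cases s <;>
    simp [armLength, bend, point, Dart.edge, Dart.vertex, TriMap.arm, triMap, TriMap.far,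
      Dart.flip, Prod.dist_eq, Real.dist_eq, abs_sub_comm]

theorem index_injective : Function.Injective Port.index := by
  intro a b h; cases a <;> cases b <;> simp_all [Port.index]

theorem before_iff (hx : Function.Injective x) (hy : Function.Injective y) (d d' : Dart G.edges) :
    Before x y d d' ↔ (triMap hG).Before x y d d' := by
  simp only [Before, TriMap.Before, ← index_port hG hx hy, PortBefore, TriMap.PortBefore,
    bendsLeft_iff hG hx hy, armLength_eq hG, Nat.cast_lt, Nat.cast_inj, index_injective.eq_iff,
    Bool.not_eq_true]

theorem respectsRotation_iff (hx : Function.Injective x) (hy : Function.Injective y) :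
    RespectsRotation x y G.toRotationDigraph ↔ ∀ d d' : Dart G.edges, d'.vertex = d.vertex →
      ¬ (((triMap hG).key x y d < (triMap hG).key x y d' ∧
          (triMap hG).key x y d' < (triMap hG).key x y (G.rot d)) ∨
        ((triMap hG).key x y d' < (triMap hG).key x y (G.rot d) ∧
          (triMap hG).key x y (G.rot d) < (triMap hG).key x y d) ∨
        ((triMap hG).key x y (G.rot d) < (triMap hG).key x y d ∧
          (triMap hG).key x y d < (triMap hG).key x y d')) := by
  simp only [RespectsRotation, ClockwiseBetween, before_iff hG hx hy, TriMap.before_iff_key]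

theorem mem_vertical_iff {e : V × V} {p : ℝ × ℝ} : p ∈ vertical x y e ↔
    p.1 = x e.1 ∧ (y e.1 ≤ p.2 ∧ p.2 ≤ y e.2 ∨ y e.2 ≤ p.2 ∧ p.2 ≤ y e.1) := by
  simp only [vertical, point, bend]
  rw [← Prod.image_mk_segment_right, segment_eq_uIcc]
  constructor
  · rintro ⟨b, hb, rfl⟩
    exact ⟨rfl, Set.mem_uIcc.1 hb⟩
  · rintro ⟨h, h'⟩
    exact ⟨p.2, Set.mem_uIcc.2 h', by rw [← h]⟩

theorem mem_horizontal_iff {e : V × V} {p : ℝ × ℝ} : p ∈ horizontal x y e ↔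
    p.2 = y e.2 ∧ (x e.1 ≤ p.1 ∧ p.1 ≤ x e.2 ∨ x e.2 ≤ p.1 ∧ p.1 ≤ x e.1) := by
  simp only [horizontal, point, bend]
  rw [← Prod.image_mk_segment_left, segment_eq_uIcc]
  constructor
  · rintro ⟨b, hb, rfl⟩
    exact ⟨rfl, Set.mem_uIcc.1 hb⟩
  · rintro ⟨h, h'⟩
    exact ⟨p.1, Set.mem_uIcc.2 h', by rw [← h]⟩

end PlaneDigraph

/-! ### Invariance under changes of coordinates that keep all comparisons along edges -/

namespace TriMap

variable {V D : Type*} {S : TriMap V D} {x y x' y' : V → ℝ}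

theorem simple_congr (hx : ∀ d, S.up x' d = S.up x d) (hy : ∀ d, S.up y' d = S.up y d) (d : D) :
    S.Simple x' y' d ↔ S.Simple x y d := by
  simp only [Simple, hx, hy]

variable (ix : Function.Injective x) (iy : Function.Injective y) (ix' : Function.Injective x')
  (iy' : Function.Injective y') (hx : ∀ d, S.up x' d = S.up x d) (hy : ∀ d, S.up y' d = S.up y d)
include ix iy ix' iy' hx hy

theorem turn_congr (d : D) : S.turn x' y' d = S.turn x y d := by
  simp only [turn_eq S ix iy, turn_eq S ix' iy', hx, hy]

/-- The far ends of `d` and of its successor are joined by the third edge of a face. Other pairs of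
darts at a vertex have no such edge, which is why the rotation is controlled through descents. -/
theorem before_rot_congr (d : D) : S.Before x' y' (S.rot d) d ↔ S.Before x y (S.rot d) d := by
  have hr : S.rot d = S.next (S.flip d) := by rw [next, S.flip_flip]
  have hne : S.far (S.rot d) ≠ S.far d := by rw [hr]; exact S.far_next_ne (S.flip d)
  have e : ∀ z : V → ℝ, decide (z (S.far (S.rot d)) < z (S.far d)) =
      S.up z (S.next (S.next (S.flip d))) := fun z => by simp [up, hr]
  rw [before_iff S _ _ (S.vtx_rot d) (fun h => hne (ix' h)) (fun h => hne (iy' h)),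
    before_iff S _ _ (S.vtx_rot d) (fun h => hne (ix h)) (fun h => hne (iy h))]
  simp only [e, hx, hy]

theorem good_congr [Fintype D] (h : S.Good x y) : S.Good x' y' where
  x_inj := ix'
  y_inj := iy'
  simple d := (simple_congr hx hy d).2 (h.simple d)
  card := by
    simp only [fun d => turn_congr ix iy ix' iy' hx hy d]
    exact h.card

end TriMap

/-! ### Crossings of polylines, and counting darts and faces -/

namespace PlaneDigraph

variable {V : Type*} {G : PlaneDigraph V} (hG : G.IsTriangulated) {x y : V → ℝ}

open LDrawing

theorem edge_mem (d : Dart G.edges) : d.edge ∈ G.edges := d.1.2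

theorem edge_of_tail {d : Dart G.edges} (h : (triMap hG).tail d = true) :
    d.edge = (d.vertex, d.flip.vertex) := by
  rcases d with ⟨e, s⟩
  cases s
  · rfl
  · simp [triMap] at h

theorem edge_of_head {d : Dart G.edges} (h : (triMap hG).tail d = false) :
    d.edge = (d.flip.vertex, d.vertex) := by
  rcases d with ⟨e, s⟩
  cases s
  · simp [triMap] at h
  · rfl

theorem between_of_decide {z : V → ℝ} {a b c : V} (hbc : z a ≠ z c) (hab : z a ≠ z b)
    (h : decide (z a < z b) = decide (z c < z a)) :
    z b < z a ∧ z a < z c ∨ z c < z a ∧ z a < z b := by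
  rw [decide_eq_decide] at h
  rcases lt_or_gt_of_ne hbc with h₁ | h₁
  · exact Or.inl ⟨lt_of_le_of_ne (not_lt.1 fun h' => h₁.not_gt (h.1 h')) hab.symm, h₁⟩
  · exact Or.inr ⟨h₁, h.2 h₁⟩

theorem decide_lt_swap {a b c : ℝ} (hab : a ≠ b) (hac : a ≠ c)
    (h : decide (b < a) = decide (a < c)) : decide (a < b) = decide (c < a) := by
  rw [decide_eq_decide] at h ⊢
  constructor
  · intro h'
    exact lt_of_le_of_ne (not_lt.1 fun k => h'.not_gt (h.2 k)) hac.symm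
  · intro h'
    exact lt_of_le_of_ne (not_lt.1 fun k => h'.not_gt (h.1 k)) hab

/-- The vertical segment of `(a, b)` would meet the horizontal segment of `(b, c)` at `(x a, y c)`.
No other kind of crossing can occur in a triangle, since edges with a common tail or head only
overlap in permitted ways. -/
theorem false_of_cross (hx : Function.Injective x) (hy : Function.Injective y)
    (hnc : NonCrossing x y G.edges) {a b c : V} (hab : (a, b) ∈ G.edges) (hbc : (b, c) ∈ G.edges)
    (hac : a ≠ c) (h₁ : decide (x a < x b) = decide (x c < x a))
    (h₂ : decide (y b < y c) = decide (y c < y a)) : False := by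
  have nab : a ≠ b := by rintro rfl; exact G.loopless _ hab
  have nbc : b ≠ c := by rintro rfl; exact G.loopless _ hbc
  have k₁ := between_of_decide (fun h => hac (hx h)) (fun h => nab (hx h)) h₁
  have k₂ := between_of_decide (z := y) (a := c) (b := a) (c := b) (fun h => nbc (hy h).symm)
    (fun h => hac (hy h).symm) h₂.symm
  have p₁ : (x a, y c) ∈ vertical x y (a, b) := mem_vertical_iff.2 ⟨rfl, by
    rcases k₂ with k | k
    · exact Or.inl ⟨k.1.le, k.2.le⟩
    · exact Or.inr ⟨k.1.le, k.2.le⟩⟩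
  have p₂ : (x a, y c) ∈ horizontal x y (b, c) := mem_horizontal_iff.2 ⟨rfl, by
    rcases k₁ with k | k
    · exact Or.inl ⟨k.1.le, k.2.le⟩
    · exact Or.inr ⟨k.1.le, k.2.le⟩⟩
  rcases hnc _ hab _ hbc (fun h => nab (congrArg Prod.fst h)) _ ⟨Or.inl p₁, Or.inr p₂⟩ with
    ⟨v, h, h', hp⟩ | ⟨h, -⟩ | ⟨h, -⟩
  · have hv : v = a := hx (congrArg Prod.fst hp).symm
    have hv' : v = c := hy (congrArg Prod.snd hp).symm
    exact hac (hv.symm.trans hv')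
  · exact nab h
  · exact nbc h

theorem cross_eq_false (hx : Function.Injective x) (hy : Function.Injective y)
    (hnc : NonCrossing x y G.edges) (d : Dart G.edges) :
    LShape.cross ((triMap hG).tail d) ((triMap hG).tail ((triMap hG).next d))
      ((triMap hG).up x d) ((triMap hG).up x ((triMap hG).next d))
      ((triMap hG).up x ((triMap hG).next ((triMap hG).next d)))
      ((triMap hG).up y d) ((triMap hG).up y ((triMap hG).next d))
      ((triMap hG).up y ((triMap hG).next ((triMap hG).next d))) = false := by
  rw [Bool.eq_false_iff]
  intro h
  have hv : ((triMap hG).next d).vertex = d.flip.vertex := (triMap hG).vtx_next d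
  have hne := (triMap hG).far_next_ne d
  simp only [LShape.cross, TriMap.up, TriMap.far_next_next, TriMap.vtx_next, Bool.or_eq_true,
    Bool.and_eq_true, beq_iff_eq, Bool.not_eq_true'] at h
  rcases h with ⟨⟨⟨t₁, t₂⟩, h₁⟩, h₂⟩ | ⟨⟨⟨t₁, t₂⟩, h₁⟩, h₂⟩
  · have e₁ := edge_of_tail hG t₁
    have e₂ := edge_of_tail hG t₂
    rw [hv] at e₂
    exact false_of_cross hx hy hnc (e₁ ▸ edge_mem d) (e₂ ▸ edge_mem _) hne.symm h₁ h₂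
  · have e₁ := edge_of_head hG t₁
    have e₂ := edge_of_head hG t₂
    rw [hv] at e₂
    exact false_of_cross hx hy hnc (e₂ ▸ edge_mem _) (e₁ ▸ edge_mem d) hne
      (decide_lt_swap (hx.ne ((triMap hG).far_next_ne_far d)) (hx.ne hne) h₁)
      (decide_lt_swap (hy.ne hne.symm) (hy.ne ((triMap hG).far_ne d).symm) h₂.symm).symm

theorem simple_of_nonCrossing (hx : Function.Injective x) (hy : Function.Injective y)
    (hnc : NonCrossing x y G.edges) (d : Dart G.edges) : (triMap hG).Simple x y d := by
  have h₁ := cross_eq_false hG hx hy hnc d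
  have h₂ := cross_eq_false hG hx hy hnc ((triMap hG).next d)
  have h₃ := cross_eq_false hG hx hy hnc ((triMap hG).next ((triMap hG).next d))
  simp only [TriMap.next_next_next] at h₂ h₃
  simp [TriMap.Simple, LShape.simple, h₁, h₂, h₃]

section

variable [Fintype (Dart G.edges)]

/-- With a common tail or head the point lies on the corresponding segments of both edges. Apart
from contact at the vertex `e.1 = f.2`, all that remains is a proper crossing. -/
theorem vertical_inter_horizontal (h : (triMap hG).Good x y) {e f : V × V} (he : e ∈ G.edges)
    (hf : f ∈ G.edges) {p : ℝ × ℝ} (hp : p ∈ vertical x y e) (hp' : p ∈ horizontal x y f) :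
    (p = point x y e.1 ∧ e.1 = f.2) ∨
    (e.1 = f.1 ∧ p ∈ vertical x y e ∩ vertical x y f) ∨
    (e.2 = f.2 ∧ p ∈ horizontal x y e ∩ horizontal x y f) := by
  obtain ⟨h₁, h₂⟩ := mem_vertical_iff.1 hp
  obtain ⟨h₃, h₄⟩ := mem_horizontal_iff.1 hp'
  by_cases c₁ : e.1 = f.2
  · exact Or.inl ⟨Prod.ext h₁ (by rw [h₃, c₁]; rfl), c₁⟩
  by_cases c₂ : e.1 = f.1
  · exact Or.inr (Or.inl ⟨c₂, hp, mem_vertical_iff.2 ⟨by rw [h₁, c₂], by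
      rw [h₃]; rcases le_total (y f.1) (y f.2) with h | h <;> simp [h]⟩⟩)
  by_cases c₃ : e.2 = f.2
  · exact Or.inr (Or.inr ⟨c₃, mem_horizontal_iff.2 ⟨by rw [h₃, c₃], by
      rw [h₁]; rcases le_total (x e.1) (x e.2) with h | h <;> simp [h]⟩, hp'⟩)
  exfalso
  rw [h₃] at h₂
  rw [h₁] at h₄
  have n₁ : x e.1 ≠ x f.1 := fun h' => c₂ (h.x_inj h')
  have n₂ : x e.1 ≠ x f.2 := fun h' => c₁ (h.x_inj h')
  have n₃ : y e.1 ≠ y f.2 := fun h' => c₁ (h.y_inj h')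
  have n₄ : y e.2 ≠ y f.2 := fun h' => c₃ (h.y_inj h')
  refine h.no_cross (e := (⟨e, he⟩, EdgeSide.tail)) (f := (⟨f, hf⟩, EdgeSide.head)) rfl rfl ?_ ?_
  · rcases h₂ with ⟨k, k'⟩ | ⟨k, k'⟩
    · exact Or.inl ⟨lt_of_le_of_ne k n₃, lt_of_le_of_ne k' n₄.symm⟩
    · exact Or.inr ⟨lt_of_le_of_ne k n₄, lt_of_le_of_ne k' n₃.symm⟩
  · rcases h₄ with ⟨k, k'⟩ | ⟨k, k'⟩
    · exact Or.inl ⟨lt_of_le_of_ne k n₁.symm, lt_of_le_of_ne k' n₂⟩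
    · exact Or.inr ⟨lt_of_le_of_ne k n₂.symm, lt_of_le_of_ne k' n₁⟩

theorem nonCrossing_of_good (h : (triMap hG).Good x y) : NonCrossing x y G.edges := by
  rintro e he f hf - p ⟨hp | hp, hp' | hp'⟩
  · exact Or.inr (Or.inl ⟨h.x_inj ((mem_vertical_iff.1 hp).1.symm.trans (mem_vertical_iff.1 hp').1),
      hp, hp'⟩)
  · rcases vertical_inter_horizontal hG h he hf hp hp' with ⟨k, k'⟩ | k
    · exact Or.inl ⟨e.1, Or.inl rfl, Or.inr k', k⟩
    · exact Or.inr k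
  · rcases vertical_inter_horizontal hG h hf he hp' hp with ⟨k, k'⟩ | ⟨k, k'⟩ | ⟨k, k'⟩
    · exact Or.inl ⟨f.1, Or.inr k', Or.inl rfl, k⟩
    · exact Or.inr (Or.inl ⟨k.symm, k'.symm⟩)
    · exact Or.inr (Or.inr ⟨k.symm, k'.symm⟩)
  · exact Or.inr (Or.inr ⟨h.y_inj ((mem_horizontal_iff.1 hp).1.symm.trans
      (mem_horizontal_iff.1 hp').1), hp, hp'⟩)

end

theorem leftFace_eq_iff (d d' : Dart G.edges) : G.leftFace d' = G.leftFace d ↔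
    d' = d ∨ d' = (triMap hG).next d ∨ d' = (triMap hG).next ((triMap hG).next d) := by
  have h₃ : G.facePerm ^ 3 = 1 := by
    ext1 e
    exact (hG e).2
  rw [RotationDigraph.leftFace, RotationDigraph.leftFace, Quotient.eq]
  change G.facePerm.SameCycle d' d ↔ _
  rw [Equiv.Perm.sameCycle_comm]
  constructor
  · rintro ⟨i, rfl⟩
    rw [← Int.emod_add_mul_ediv i 3, zpow_add, zpow_mul, zpow_ofNat, h₃, one_zpow, mul_one]
    have h₀ := Int.emod_nonneg i (by norm_num : (3 : ℤ) ≠ 0)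
    have h₁ := Int.emod_lt_of_pos i (by norm_num : (0 : ℤ) < 3)
    have : i % 3 = 0 ∨ i % 3 = 1 ∨ i % 3 = 2 := by omega
    rcases this with h | h | h <;> rw [h]
    · exact Or.inl rfl
    · exact Or.inr (Or.inl rfl)
    · exact Or.inr (Or.inr rfl)
  · rintro (rfl | rfl | rfl)
    · exact Equiv.Perm.SameCycle.refl _ _
    · exact (Equiv.Perm.SameCycle.refl _ _).apply_right
    · exact (Equiv.Perm.SameCycle.refl _ _).apply_right.apply_right

include hG in
theorem three_mul_card_face [Finite V] :
    3 * Nat.card G.Face = Nat.card (Dart G.edges) := by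
  classical
  have := Fintype.ofFinite (Dart G.edges)
  have := Fintype.ofFinite G.Face
  rw [Nat.card_eq_fintype_card, Nat.card_eq_fintype_card, ← Finset.card_univ (α := Dart G.edges),
    Finset.card_eq_sum_card_fiberwise (f := G.leftFace) (t := Finset.univ)
      (fun _ _ => Finset.mem_coe.2 (Finset.mem_univ _))]
  rw [Finset.sum_const_nat (m := 3), Finset.card_univ, mul_comm]
  intro F _
  obtain ⟨d, rfl⟩ := Quotient.exists_rep F
  have : (Finset.univ.filter fun e => G.leftFace e = Quotient.mk _ d) =
      {d, (triMap hG).next d, (triMap hG).next ((triMap hG).next d)} := by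
    ext e
    simp only [Finset.mem_filter, Finset.mem_univ, true_and, Finset.mem_insert,
      Finset.mem_singleton]
    exact leftFace_eq_iff hG d e
  rw [this, Finset.card_insert_of_notMem, Finset.card_pair]
  · exact ((triMap hG).next_ne _).symm
  · simp [((triMap hG).next_ne d).symm, ((triMap hG).next_next_ne d).symm]

theorem card_dart : Nat.card (Dart G.edges) = 2 * G.edges.card := by
  have e : EdgeSide ≃ Bool := ⟨fun s => match s with
    | EdgeSide.tail => true
    | EdgeSide.head => false, fun b => if b then EdgeSide.tail else EdgeSide.head,
    by rintro (_ | _) <;> rfl, by rintro (_ | _) <;> rfl⟩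
  rw [Dart, Nat.card_prod, Nat.card_congr e]
  simp [mul_comm]

/-- The outer face supplies one dart, and having a dart spreads along edges to all vertices. -/
theorem exists_dart (v : V) : ∃ d : Dart G.edges, d.vertex = v := by
  obtain ⟨d₀, -⟩ := Quotient.exists_rep G.outerFace
  have key : ∀ a b, Relation.EqvGen (fun a b => (a, b) ∈ G.edges) a b →
      ((∃ d : Dart G.edges, d.vertex = a) ↔ ∃ d : Dart G.edges, d.vertex = b) := by
    intro a b hab
    induction hab with
    | rel a b h => exact ⟨fun _ => ⟨(⟨(a, b), h⟩, EdgeSide.head), rfl⟩,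
        fun _ => ⟨(⟨(a, b), h⟩, EdgeSide.tail), rfl⟩⟩
    | refl a => rfl
    | symm a b _ ih => exact ih.symm
    | trans a b c _ _ ih ih' => exact ih.trans ih'
  exact (key _ _ (G.connected d₀.vertex v)).1 ⟨d₀, rfl⟩

end PlaneDigraph

/-! ### Port assignments as comparisons of coordinates -/

namespace PlaneDigraph

variable {V : Type*} {G : PlaneDigraph V} (hG : G.IsTriangulated) {x y : V → ℝ}

open LDrawing

/-- The comparisons of coordinates prescribed by a port assignment. -/
theorem realizes_iff (hx : Function.Injective x) (hy : Function.Injective y)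
    (P : PortAssignment G) : Realizes x y P ↔
      (∀ v w, P.digraphX.Adj v w → x v < x w) ∧ (∀ v w, P.digraphY.Adj v w → y v < y w) := by
  have hne : ∀ e : {e : V × V // e ∈ G.edges}, e.1.1 ≠ e.1.2 := by
    rintro ⟨⟨u, v⟩, h⟩ (rfl : u = v)
    exact G.loopless u h
  have key : ∀ e : {e : V × V // e ∈ G.edges},
      (port x y ((e, EdgeSide.tail) : Dart G.edges) =
        if y e.1.1 < y e.1.2 then Port.north else Port.south) ∧
      (port x y ((e, EdgeSide.head) : Dart G.edges) =
        if x e.1.1 < x e.1.2 then Port.west else Port.east) := by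
    intro e
    have h₁ := hx.ne (hne e)
    have h₂ := hy.ne (hne e)
    simp only [port, bend, point, Dart.edge, Dart.vertex, Prod.fst_sub, Prod.snd_sub, sub_pos,
      sub_self, lt_irrefl, sub_neg, if_false]
    constructor
    · rcases lt_or_gt_of_ne h₂ with h | h <;> simp [h, h.not_gt]
    · rcases lt_or_gt_of_ne h₁ with h | h <;> simp [h, h.not_gt]
  constructor
  · intro h
    constructor
    · rintro v w (⟨hm, hp⟩ | ⟨hm, hp⟩)
      · have := (h ⟨_, hm⟩).2
        rw [hp, (key _).2] at this
        by_contra hc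
        simp [hc, InPort.toPort] at this
      · have := (h ⟨_, hm⟩).2
        rw [hp, (key _).2] at this
        refine lt_of_le_of_ne (not_lt.1 fun hc => ?_) (hx.ne (hne ⟨_, hm⟩).symm)
        simp [hc, InPort.toPort] at this
    · rintro v w (⟨hm, hp⟩ | ⟨hm, hp⟩)
      · have := (h ⟨_, hm⟩).1
        rw [hp, (key _).1] at this
        by_contra hc
        simp [hc, OutPort.toPort] at this
      · have := (h ⟨_, hm⟩).1
        rw [hp, (key _).1] at this
        refine lt_of_le_of_ne (not_lt.1 fun hc => ?_) (hy.ne (hne ⟨_, hm⟩).symm)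
        simp [hc, OutPort.toPort] at this
  · rintro ⟨hX, hY⟩ ⟨⟨u, v⟩, hm⟩
    rw [(key _).1, (key _).2]
    constructor
    · cases hp : P.outPort ⟨(u, v), hm⟩
      · have := hY u v (Or.inl ⟨hm, hp⟩)
        simp [this, OutPort.toPort]
      · have := hY v u (Or.inr ⟨hm, hp⟩)
        simp [this.not_gt, OutPort.toPort]
    · cases hp : P.inPort ⟨(u, v), hm⟩
      · have := hX v u (Or.inr ⟨hm, hp⟩)
        simp [this.not_gt, InPort.toPort]
      · have := hX u v (Or.inl ⟨hm, hp⟩)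
        simp [this, InPort.toPort]

theorem isAcyclic_of_lt {D : Digraph V} (h : ∀ v w, D.Adj v w → x v < x w) : D.IsAcyclic := by
  intro v hv
  have : ∀ w, Relation.TransGen D.Adj v w → x v < x w := by
    intro w hw
    induction hw with
    | single h' => exact h _ _ h'
    | tail _ h' ih => exact ih.trans (h _ _ h')
  exact lt_irrefl _ (this v hv)

theorem adjX_or (P : PortAssignment G) (d : Dart G.edges) :
    P.digraphX.Adj d.vertex d.flip.vertex ∨ P.digraphX.Adj d.flip.vertex d.vertex := by
  rcases d with ⟨⟨⟨u, v⟩, h⟩, s⟩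
  cases hp : P.inPort ⟨(u, v), h⟩ <;> cases s
  · exact Or.inr (Or.inr ⟨h, hp⟩)
  · exact Or.inl (Or.inr ⟨h, hp⟩)
  · exact Or.inl (Or.inl ⟨h, hp⟩)
  · exact Or.inr (Or.inl ⟨h, hp⟩)

theorem adjY_or (P : PortAssignment G) (d : Dart G.edges) :
    P.digraphY.Adj d.vertex d.flip.vertex ∨ P.digraphY.Adj d.flip.vertex d.vertex := by
  rcases d with ⟨⟨⟨u, v⟩, h⟩, s⟩
  cases hp : P.outPort ⟨(u, v), h⟩ <;> cases s
  · exact Or.inl (Or.inl ⟨h, hp⟩)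
  · exact Or.inr (Or.inl ⟨h, hp⟩)
  · exact Or.inr (Or.inr ⟨h, hp⟩)
  · exact Or.inl (Or.inr ⟨h, hp⟩)

/-- Labels increasing along a digraph that joins the ends of every edge agree on the edges. -/
theorem up_congr {D : Digraph V} {z z' : V → ℝ}
    (hD : ∀ d : Dart G.edges, D.Adj d.vertex d.flip.vertex ∨ D.Adj d.flip.vertex d.vertex)
    (hz : ∀ v w, D.Adj v w → z v < z w) (hz' : ∀ v w, D.Adj v w → z' v < z' w)
    (d : Dart G.edges) : (triMap hG).up z' d = (triMap hG).up z d := by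
  simp only [TriMap.up, triMap_vtx, triMap_far]
  rcases hD d with h | h
  · simp [hz _ _ h, hz' _ _ h]
  · simp [(hz _ _ h).not_gt, (hz' _ _ h).not_gt]

theorem existsUnique_descent_of_respectsRotation [Finite (Dart G.edges)]
    (hx : Function.Injective x) (hy : Function.Injective y)
    (h : RespectsRotation x y G.toRotationDigraph) (d₀ : Dart G.edges) :
    ∃! d : Dart G.edges, (triMap hG).vtx d = (triMap hG).vtx d₀ ∧
      (triMap hG).Before x y ((triMap hG).rot d) d := by
  simp only [TriMap.before_iff_key]
  exact existsUnique_descent (triMap hG).vtx_rot (triMap hG).rot_ne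
    (fun d d' => (triMap hG).eq_of_key_eq hx hy) ((respectsRotation_iff hG hx hy).1 h) d₀

theorem respectsRotation_of_descents [Finite (Dart G.edges)]
    (hx : Function.Injective x) (hy : Function.Injective y)
    (h : ∀ d₀, ∃! d : Dart G.edges, (triMap hG).vtx d = (triMap hG).vtx d₀ ∧
      (triMap hG).Before x y ((triMap hG).rot d) d) :
    RespectsRotation x y G.toRotationDigraph := by
  simp only [TriMap.before_iff_key] at h
  exact (respectsRotation_iff hG hx hy).2 (not_between_of_descent_unique (triMap hG).vtx_rot
    (triMap hG).rot_ne (fun d d' => (triMap hG).eq_of_key_eq hx hy)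
    (fun d d' hv h₁ h₂ => (h d').unique ⟨hv, h₁⟩ ⟨rfl, h₂⟩))

theorem good_of_isPlanar [Finite V] [Fintype (Dart G.edges)] (hx : Function.Injective x)
    (hy : Function.Injective y) (hnc : NonCrossing x y G.edges)
    (hr : RespectsRotation x y G.toRotationDigraph) : (triMap hG).Good x y := by
  have := Fintype.ofFinite V
  refine TriMap.good_of_euler hx hy (S := triMap hG) exists_dart
    (existsUnique_descent_of_respectsRotation hG hx hy hr)
    (simple_of_nonCrossing hG hx hy hnc) ?_
  -- Since `|D| = 2 |E| = 3 |F|`, Euler's formula becomes `|D| + 12 = 6 |V|`.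
  have h₁ := G.euler
  have h₂ := three_mul_card_face hG
  have h₃ := card_dart (G := G)
  rw [Nat.card_eq_fintype_card (α := Dart G.edges)] at h₂ h₃
  rw [Nat.card_eq_fintype_card] at h₁
  omega

end PlaneDigraph

/-! ### Jumps of winding numbers and rays that escape -/

namespace TriMap

variable {V D : Type*} (S : TriMap V D)

/-- The tail of the edge of a dart. -/
def tl (d : D) : V := if S.tail d then S.vtx d else S.far d

/-- The vertical segment is at the tail, so `A` matters only there, and only if the horizontal line
separates the ends of the edge. -/
theorem wind_congr {A A' B : V → Bool} {d : D}
    (h : A (S.tl d) = A' (S.tl d) ∨ B (S.vtx d) = B (S.far d)) :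
    S.wind A B d = S.wind A' B d := by
  simp only [wind, LShape.wind, tl] at *
  cases ht : S.tail d <;> rcases h with h | h <;> simp_all

theorem winding_congr_left {A A' B : V → Bool} (d : D)
    (h : ∀ c, (c = d ∨ c = S.next d ∨ c = S.next (S.next d)) →
      A (S.tl c) = A' (S.tl c) ∨ B (S.vtx c) = B (S.far c)) :
    S.winding A B d = S.winding A' B d := by
  rw [winding, winding, S.wind_congr (h _ (Or.inl rfl)), S.wind_congr (h _ (Or.inr (Or.inl rfl))),
    S.wind_congr (h _ (Or.inr (Or.inr rfl)))]

theorem winding_congr_right {A B B' : V → Bool} (d : D)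
    (h : ∀ c, B (S.reverse.tl c) = B' (S.reverse.tl c) ∨ A (S.vtx c) = A (S.far c)) :
    S.winding A B d = S.winding A B' d := by
  rw [← S.winding_reverse, ← S.winding_reverse A]
  exact S.reverse.winding_congr_left d fun c _ => (h c).imp id fun h => by simp [h]

theorem winding_eq_zero_left {A B : V → Bool} (d : D) (h : ∀ c, B (S.vtx c) = B (S.far c)) :
    S.winding A B d = 0 := by
  rw [S.winding_congr_left (A' := fun _ => false) d fun c _ => Or.inr (h c)]
  simp [winding, wind, LShape.wind, LShape.ind]

theorem winding_eq_zero_right {A B : V → Bool} (d : D) (h : ∀ c, A (S.vtx c) = A (S.far c)) :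
    S.winding A B d = 0 := by
  rw [← S.winding_reverse]
  exact S.reverse.winding_eq_zero_left d fun c => by simp [h]

theorem leftSide_of_ne {x : V → ℝ} (hx : Function.Injective x) {u v : V} (h : v ≠ u) (b b' : Bool) :
    leftSide b x u v = leftSide b' x u v := by
  have : x u ≠ x v := fun h' => h (hx h').symm
  have key : atLeast x u v = beyond x (x u) v := by
    simp only [atLeast, beyond, decide_eq_decide]
    exact ⟨fun h' => lt_of_le_of_ne h' this, le_of_lt⟩
  cases b <;> cases b' <;> simp [leftSide, key]

/-- The winding number jumps across a vertical segment that is on no other edge. -/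
theorem winding_jump_left {x : V → ℝ} (hx : Function.Injective x) {B : V → Bool} {d : D}
    (hd : B (S.far d) ≠ B (S.vtx d))
    (h : ∀ c, c ≠ d → c ≠ S.flip d → S.tl c = S.tl d → B (S.vtx c) = B (S.far c)) :
    S.winding (leftSide (!B (S.far d)) x (S.tl d)) B d =
      S.winding (leftSide (B (S.far d)) x (S.tl d)) B d + 1 := by
  have key : ∀ c, c ≠ d → c ≠ S.flip d →
      S.wind (leftSide (!B (S.far d)) x (S.tl d)) B c =
        S.wind (leftSide (B (S.far d)) x (S.tl d)) B c := by
    intro c h₁ h₂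
    refine S.wind_congr ?_
    by_cases hc : S.tl c = S.tl d
    · exact Or.inr (h c h₁ h₂ hc)
    · exact Or.inl (leftSide_of_ne hx hc _ _)
  have n₁ : S.next d ≠ S.flip d := fun h' => S.far_next_ne d (by rw [h', far_flip])
  have n₂ : S.next (S.next d) ≠ S.flip d := fun h' => S.far_next_ne_far d (by
    rw [← S.vtx_next (S.next d), h', vtx_flip])
  rw [winding, winding, key _ (S.next_ne d) n₁, key _ (S.next_next_ne d) n₂]
  suffices S.wind (leftSide (!B (S.far d)) x (S.tl d)) B d =
      S.wind (leftSide (B (S.far d)) x (S.tl d)) B d + 1 by omega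
  have e₁ : leftSide false x (S.tl d) (S.tl d) = true := by simp [leftSide, atLeast]
  have e₂ : leftSide true x (S.tl d) (S.tl d) = false := by simp [leftSide, beyond]
  revert hd e₁ e₂
  simp only [wind, LShape.wind, tl]
  cases S.tail d <;> cases B (S.far d) <;> cases B (S.vtx d) <;>
    simp +contextual [LShape.ind]

/-- The winding number jumps across a horizontal segment that is on no other edge. -/
theorem winding_jump_right {y : V → ℝ} (hy : Function.Injective y) {A : V → Bool} {d : D}
    (hd : A (S.far d) ≠ A (S.vtx d))
    (h : ∀ c, c ≠ d → c ≠ S.flip d → S.reverse.tl c = S.reverse.tl d →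
      A (S.vtx c) = A (S.far c)) :
    S.winding A (leftSide (A (S.far d)) y (S.reverse.tl d)) d =
      S.winding A (leftSide (!A (S.far d)) y (S.reverse.tl d)) d + 1 := by
  have := S.reverse.winding_jump_left hy (B := fun v => !A v) (d := d) (by simpa using hd)
    (fun c h₁ h₂ h₃ => by simp [h c h₁ h₂ h₃])
  simpa only [reverse_far, Bool.not_not, winding_reverse] using this

namespace Good

variable {S} [Fintype D] {x y : V → ℝ} (h : S.Good x y)
include h

/-- From a point outside of the clockwise triangle one can leave to the east or to the west without
meeting a vertical segment. -/
theorem exists_free_direction {a : ℝ} {B : V → Bool} (hB : Upper y B) {d : D}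
    (ht : S.turn x y d = -4) (hw : S.winding (beyond x a) B d = 0) :
    ∃ e : Bool, ∀ c, B (S.vtx c) ≠ B (S.far c) → beyond x a (S.tl c) ≠ e := by
  have hA := upper_beyond x a
  obtain ⟨e, he⟩ : ∃ e : Bool, ∀ c, (c = d ∨ c = S.next d ∨ c = S.next (S.next d)) →
      B (S.vtx c) ≠ B (S.far c) → beyond x a (S.tl c) ≠ e := by
    have ht' := ht
    have hw' := hw
    rw [S.turn_eq h.x_inj h.y_inj] at ht'
    rw [winding_eq] at hw'
    have := LShape.exists_free_ray _ _ _ _ _ _ _ _ _ (S.acyclic_up h.x_inj d)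
      (S.acyclic_up h.y_inj d) (h.simple d) ht' _ _ _ (S.mono₃_up hA d) _ _ _ (S.mono₃_up hB d) hw'
    have key : ∀ e : Bool, LShape.free e (S.tail d) (S.tail (S.next d)) (S.tail (S.next (S.next d)))
        (beyond x a (S.vtx d)) (beyond x a (S.far d)) (beyond x a (S.far (S.next d)))
        (B (S.vtx d)) (B (S.far d)) (B (S.far (S.next d))) = true →
        ∀ c, (c = d ∨ c = S.next d ∨ c = S.next (S.next d)) →
          B (S.vtx c) ≠ B (S.far c) → beyond x a (S.tl c) ≠ e := by
      intro e hf c hc hcB hce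
      simp only [LShape.free, LShape.hit, Bool.and_eq_true, Bool.not_eq_true',
        Bool.and_eq_false_iff] at hf
      have e₁ : ∀ c, (if S.tail c = true then beyond x a (S.vtx c) else beyond x a (S.far c)) =
          beyond x a (S.tl c) := fun c => by simp only [tl]; split_ifs <;> rfl
      have e₂ := e₁ (S.next d)
      have e₃ := e₁ (S.next (S.next d))
      simp only [vtx_next, far_next_next] at e₂ e₃
      rw [e₁, e₂, e₃] at hf
      rcases hc with rfl | rfl | rfl
      · rcases hf.1.1 with h' | h' <;> simp_all
      · rcases hf.1.2 with h' | h' <;> simp_all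
      · rcases hf.2 with h' | h' <;> simp_all
    rcases this with h' | h'
    · exact ⟨true, key _ h'⟩
    · exact ⟨false, key _ h'⟩
  refine ⟨e, ?_⟩
  -- Suppose a vertical segment at another place met the ray. On that side no edge of the triangle
  -- of `d` has a vertical segment on the line, so points right beside the segment still lie in the
  -- clockwise face. They also lie in the left face of the first such segment at this vertex, which
  -- is therefore an edge of the triangle.
  have main : ∀ c, S.tail c = true → B (S.vtx c) ≠ B (S.far c) → beyond x a (S.vtx c) ≠ e := by
    intro c hc hcB hce
    obtain ⟨c₁, h₁, h₂, h₃, -, h₄⟩ := h.exists_first hB hc hcB.symm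
    have hd : S.chi x y (leftSide (B (S.vtx c)) x (S.vtx c)) B d = 1 := by
      rw [chi, ht, if_pos rfl, S.winding_congr_left d (A' := beyond x a), hw, zero_add]
      intro c' hc'
      by_cases hB' : B (S.vtx c') = B (S.far c')
      · exact Or.inr hB'
      left
      have hf := he c' hc' hB'
      rw [← hce] at hf
      have hl : leftSide (B (S.vtx c)) x (S.vtx c) = atLeast x (S.vtx c) ∨
          leftSide (B (S.vtx c)) x (S.vtx c) = beyond x (x (S.vtx c)) := by
        cases B (S.vtx c)
        · exact Or.inl rfl
        · exact Or.inr rfl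
      rcases hl with hl | hl <;> rw [hl] <;> simp only [beyond, atLeast, ne_eq, decide_eq_decide] at hf ⊢ <;>
        constructor <;> intro hi <;> by_contra hi' <;> apply hf <;> constructor <;> intro hj <;>
        linarith
    refine he c₁ (h.eq_of_chi_eq_one (upper_leftSide _ _ _) hB hd h₄) h₃.symm ?_
    rw [tl, h₂, if_pos rfl, h₁, hce]
  intro c hcB
  cases hc : S.tail c
  · have := main (S.flip c) (by rw [S.tail_flip, hc]; rfl) (by simpa using hcB.symm)
    simpa [tl, hc] using this
  · have := main c hc hcB
    simpa [tl, hc] using this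

end Good

end TriMap

/-! ### Winding numbers and the outer region -/

namespace PlaneDigraph

variable {V : Type*} {G : PlaneDigraph V} (hG : G.IsTriangulated) {x y : V → ℝ}

open LDrawing TriMap

theorem tl_eq (d : Dart G.edges) : (triMap hG).tl d = d.edge.1 := by
  rcases d with ⟨e, s⟩; cases s <;> rfl

theorem hd_eq (d : Dart G.edges) : (triMap hG).reverse.tl d = d.edge.2 := by
  rcases d with ⟨e, s⟩; cases s <;> rfl

theorem vertex_or (d : Dart G.edges) : (d.vertex = d.edge.1 ∧ d.flip.vertex = d.edge.2) ∨
    (d.vertex = d.edge.2 ∧ d.flip.vertex = d.edge.1) := by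
  rcases d with ⟨e, s⟩
  cases s
  · exact Or.inl ⟨rfl, rfl⟩
  · exact Or.inr ⟨rfl, rfl⟩

theorem edge_eq_iff {c d : Dart G.edges} : c.edge = d.edge ↔ c = d ∨ c = d.flip := by
  constructor
  · rcases c with ⟨e, s⟩
    rcases d with ⟨f, t⟩
    intro h
    obtain rfl : e = f := Subtype.ext h
    cases s <;> cases t <;> first | exact Or.inl rfl | exact Or.inr rfl
  · rintro (rfl | rfl)
    · rfl
    · rcases d with ⟨e, s⟩; cases s <;> rfl

/-- An edge whose ends are on different sides of a horizontal line has its vertical segment there. -/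
theorem mem_vertical_of_ne {d : Dart G.edges} {b : ℝ}
    (h : beyond y b d.vertex ≠ beyond y b d.flip.vertex) : (x d.edge.1, b) ∈ vertical x y d.edge := by
  rw [mem_vertical_iff]
  refine ⟨rfl, ?_⟩
  simp only [beyond, ne_eq, decide_eq_decide] at h
  rcases vertex_or d with ⟨h₁, h₂⟩ | ⟨h₁, h₂⟩ <;> rw [h₁, h₂] at h <;>
    rcases lt_or_ge b (y d.edge.1) with k | k <;> rcases lt_or_ge b (y d.edge.2) with k' | k' <;>
    first
    | exact Or.inl ⟨k, k'.le⟩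
    | exact Or.inr ⟨k', k.le⟩
    | (exfalso; apply h; constructor <;> intro <;> linarith)

theorem mem_horizontal_of_ne {d : Dart G.edges} {a : ℝ}
    (h : beyond x a d.vertex ≠ beyond x a d.flip.vertex) :
    (a, y d.edge.2) ∈ horizontal x y d.edge := by
  rw [mem_horizontal_iff]
  refine ⟨rfl, ?_⟩
  simp only [beyond, ne_eq, decide_eq_decide] at h
  rcases vertex_or d with ⟨h₁, h₂⟩ | ⟨h₁, h₂⟩ <;> rw [h₁, h₂] at h <;>
    rcases lt_or_ge a (x d.edge.1) with k | k <;> rcases lt_or_ge a (x d.edge.2) with k' | k' <;>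
    first
    | exact Or.inl ⟨k, k'.le⟩
    | exact Or.inr ⟨k', k.le⟩
    | (exfalso; apply h; constructor <;> intro <;> linarith)

theorem polyline_subset_drawing {e : V × V} (he : e ∈ G.edges) :
    polyline x y e ⊆ drawing x y G.edges := fun p hp =>
  Or.inr (Set.mem_biUnion (by exact he) hp)

theorem isClosed_drawing [Finite V] : IsClosed (drawing x y G.edges) := by
  have hseg : ∀ a b : ℝ × ℝ, IsClosed (segment ℝ a b) := fun a b => by
    rw [segment_eq_image]
    exact (isCompact_Icc.image (by fun_prop)).isClosed
  refine (Set.finite_range _).isClosed.union ?_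
  exact isClosed_biUnion_finset fun e _ => (hseg _ _).union (hseg _ _)

theorem eventually_lt_iff [Finite V] (z : V → ℝ) (a : ℝ) :
    ∀ᶠ a' in 𝓝 a, ∀ v, z v ≠ a → (a' < z v ↔ a < z v) := by
  refine eventually_all.2 fun v => ?_
  by_cases h : z v = a
  · simp [h]
  rcases lt_or_gt_of_ne h with h' | h'
  · filter_upwards [lt_mem_nhds h'] with a' ha' _
    exact ⟨fun k => absurd (ha'.trans k) (lt_irrefl _), fun k => absurd (h'.trans k) (lt_irrefl _)⟩
  · filter_upwards [gt_mem_nhds h'] with a' ha' _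
    exact ⟨fun _ => h', fun _ => ha'⟩

/-- The winding number of a face around a point. -/
noncomputable def windingAt (x y : V → ℝ) (d : Dart G.edges) (q : ℝ × ℝ) : ℤ :=
  (triMap hG).winding (beyond x q.1) (beyond y q.2) d

/-- The coordinates are moved one at a time, through `(p.1, q.2)`. A small move alters an indicator
only at vertices sharing a coordinate with `q`; if this affected the winding number, `q` or `(p.1,
q.2)` would be on a segment of the drawing. -/
theorem windingAt_eventuallyEq [Finite V] (d : Dart G.edges) {q : ℝ × ℝ}
    (hq : q ∉ drawing x y G.edges) :
    windingAt hG x y d =ᶠ[𝓝 q] fun _ => windingAt hG x y d q := by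
  obtain ⟨ε, hε, hball⟩ := Metric.isOpen_iff.1 (isClosed_drawing (G := G) (x := x) (y := y)).isOpen_compl
    q hq
  have h₁ := continuous_fst.continuousAt.eventually (eventually_lt_iff x q.1)
  have h₂ := continuous_snd.continuousAt.eventually (eventually_lt_iff y q.2)
  filter_upwards [Metric.ball_mem_nhds q hε, h₁, h₂] with p hp k₁ k₂
  have hmid : (p.1, q.2) ∉ drawing x y G.edges := by
    refine hball ?_
    rw [Metric.mem_ball, Prod.dist_eq] at hp ⊢
    exact max_lt ((le_max_left _ _).trans_lt hp) (by simpa using hε)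
  rw [windingAt, windingAt]
  trans (triMap hG).winding (beyond x p.1) (beyond y q.2) d
  · refine (triMap hG).winding_congr_right d fun c => ?_
    by_contra! hc
    obtain ⟨c₁, c₂⟩ := hc
    rw [hd_eq] at c₁
    have e : y c.edge.2 = q.2 := by
      by_contra hne
      exact c₁ (decide_eq_decide.2 (k₂ _ hne))
    have := mem_horizontal_of_ne (y := y) c₂
    rw [e] at this
    exact hmid (polyline_subset_drawing c.1.2 (Or.inr this))
  · refine (triMap hG).winding_congr_left d fun c _ => ?_
    by_contra! hc
    obtain ⟨c₁, c₂⟩ := hc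
    rw [tl_eq] at c₁
    have e : x c.edge.1 = q.1 := by
      by_contra hne
      exact c₁ (decide_eq_decide.2 (k₁ _ hne))
    have := mem_vertical_of_ne (x := x) c₂
    rw [e] at this
    exact hq (polyline_subset_drawing c.1.2 (Or.inl this))

theorem windingAt_eq_zero_of_far [Finite V] (d : Dart G.edges) :
    ∃ R : ℝ, ∀ q : ℝ × ℝ, R < ‖q‖ → windingAt hG x y d q = 0 := by
  obtain ⟨R₁, h₁⟩ := (Set.finite_range fun v => |x v|).bddAbove
  obtain ⟨R₂, h₂⟩ := (Set.finite_range fun v => |y v|).bddAbove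
  refine ⟨max R₁ R₂, fun q hq => ?_⟩
  rw [Prod.norm_def, lt_max_iff] at hq
  have b₁ : ∀ v, |x v| ≤ max R₁ R₂ := fun v => (h₁ ⟨v, rfl⟩).trans (le_max_left _ _)
  have b₂ : ∀ v, |y v| ≤ max R₁ R₂ := fun v => (h₂ ⟨v, rfl⟩).trans (le_max_right _ _)
  have key : ∀ (z : V → ℝ) (a : ℝ), (∀ v, |z v| ≤ max R₁ R₂) → max R₁ R₂ < ‖a‖ →
      ∀ u v, beyond z a u = beyond z a v := by
    intro z a hz ha u v
    simp only [beyond, decide_eq_decide]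
    rw [Real.norm_eq_abs, lt_abs] at ha
    have hu := abs_le.1 (hz u)
    have hv := abs_le.1 (hz v)
    constructor <;> intro <;> rcases ha with ha | ha <;> linarith
  rcases hq with hq | hq
  · exact (triMap hG).winding_eq_zero_right d fun c => key x _ b₁ hq _ _
  · exact (triMap hG).winding_eq_zero_left d fun c => key y _ b₂ hq _ _

/-- All winding numbers vanish in the outer region. -/
theorem windingAt_eq_zero_of_mem_outerRegion [Finite V] (d : Dart G.edges) {q : ℝ × ℝ}
    (hq : q ∈ outerRegion x y G.edges) : windingAt hG x y d q = 0 := by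
  obtain ⟨hq₁, hq₂⟩ := hq
  obtain ⟨R, hR⟩ := windingAt_eq_zero_of_far hG (x := x) (y := y) d
  obtain ⟨p, hp, hpR⟩ : ∃ p ∈ connectedComponentIn (drawing x y G.edges)ᶜ q, R < ‖p‖ := by
    by_contra! hc
    exact hq₂ (Metric.isBounded_closedBall.subset fun p hp => mem_closedBall_zero_iff.2 (hc p hp))
  have hcont : ContinuousOn (windingAt hG x y d) (connectedComponentIn (drawing x y G.edges)ᶜ q) :=
    fun r hr => ((continuousAt_const.congr (windingAt_eventuallyEq hG d
      (connectedComponentIn_subset _ _ hr)).symm)).continuousWithinAt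
  have := (isPreconnected_connectedComponentIn.image _ hcont).subsingleton
    (Set.mem_image_of_mem _ (mem_connectedComponentIn hq₁)) (Set.mem_image_of_mem _ hp)
  rw [this, hR p hpR]

/-- A ray that avoids the drawing is in the outer region. -/
theorem mem_outerRegion_of_ray {q : ℝ × ℝ} (e : Bool)
    (h : ∀ s : ℝ, 0 ≤ s → (q.1 + (if e then s else -s), q.2) ∉ drawing x y G.edges) :
    q ∈ outerRegion x y G.edges := by
  set f : ℝ → ℝ × ℝ := fun s => (q.1 + (if e then s else -s), q.2) with hf
  have hfc : Continuous f := by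
    cases e <;> simp only [hf, if_true, Bool.false_eq_true, if_false] <;> fun_prop
  have hq : f 0 = q := by cases e <;> simp [hf]
  have hmem : q ∈ f '' Set.Ici 0 := ⟨0, Set.mem_Ici.2 le_rfl, hq⟩
  have hsub : f '' Set.Ici 0 ⊆ (drawing x y G.edges)ᶜ := by
    rintro _ ⟨s, hs, rfl⟩
    exact h s hs
  have hcomp := (isPreconnected_Ici.image f hfc.continuousOn).subset_connectedComponentIn hmem hsub
  refine ⟨hsub hmem, fun hb => ?_⟩
  obtain ⟨R, hR⟩ := (hb.subset hcomp).exists_norm_le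
  have h₁ := hR _ ⟨|R| + |q.1| + 1, Set.mem_Ici.2 (by positivity), rfl⟩
  have h₂ := (norm_fst_le (f (|R| + |q.1| + 1))).trans h₁
  rw [Real.norm_eq_abs, abs_le] at h₂
  have h₃ := le_abs_self R
  have h₄ := le_abs_self q.1
  have h₅ := neg_abs_le q.1
  have h₆ := abs_nonneg R
  cases e <;> simp [hf] at h₂ <;> linarith [h₂.1, h₂.2]

variable [Fintype (Dart G.edges)]

/-- A point of general position outside of the clockwise triangle is in the outer region. -/
theorem mem_outerRegion_of_windingAt_eq_zero (h : (triMap hG).Good x y) {d : Dart G.edges}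
    (ht : (triMap hG).turn x y d = -4) {q : ℝ × ℝ} (hq₁ : ∀ v, x v ≠ q.1) (hq₂ : ∀ v, y v ≠ q.2)
    (hw : windingAt hG x y d q = 0) : q ∈ outerRegion x y G.edges := by
  obtain ⟨e, he⟩ := h.exists_free_direction (upper_beyond y q.2) ht hw
  refine mem_outerRegion_of_ray e fun s hs hmem => ?_
  rcases hmem with ⟨v, hv⟩ | hmem
  · exact hq₂ v (congrArg Prod.snd hv)
  · simp only [Set.mem_iUnion] at hmem
    obtain ⟨f, hf, hp | hp⟩ := hmem
    · obtain ⟨h₁, h₂⟩ := mem_vertical_iff.1 hp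
      simp only at h₁ h₂
      have h₃ := hq₂ f.1
      have h₄ := hq₂ f.2
      have h₅ := hq₁ f.1
      refine he (⟨f, hf⟩, EdgeSide.tail) ?_ ?_
      · change beyond y q.2 f.1 ≠ beyond y q.2 f.2
        simp only [beyond, ne_eq, decide_eq_decide]
        rcases h₂ with ⟨k, k'⟩ | ⟨k, k'⟩
        · have := lt_of_le_of_ne k' h₄.symm
          intro hc
          linarith [hc.2 this]
        · have := lt_of_le_of_ne k' h₃.symm
          intro hc
          linarith [hc.1 this]
      · change beyond x q.1 f.1 = e
        cases e
        · simp only [Bool.false_eq_true, if_false] at h₁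
          simp only [beyond, decide_eq_false_iff_not, not_lt]
          linarith
        · simp only [if_true] at h₁
          simp only [beyond, decide_eq_true_eq]
          exact lt_of_le_of_ne (by linarith) h₅.symm
    · exact hq₂ _ (mem_horizontal_iff.1 hp).1.symm

end PlaneDigraph

/-! ### Darts with the outer region on their left -/

namespace PlaneDigraph

variable {V : Type*} {G : PlaneDigraph V} (hG : G.IsTriangulated) {x y : V → ℝ}

open LDrawing TriMap

/-- This realizes the infinitesimal displacements behind `leftSide` by actual points in general
position. -/
theorem eventually_ne_and_beyond [Finite V] {z : V → ℝ} (hz : Function.Injective z) (u : V) {k : ℝ}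
    (hk : k ≠ 0) : ∀ᶠ ε in 𝓝[>] (0 : ℝ), (∀ v, z v ≠ z u + ε * k) ∧
      beyond z (z u + ε * k) = leftSide (decide (0 < k)) z u := by
  have hc : Tendsto (fun ε : ℝ => z u + ε * k) (𝓝[>] 0) (𝓝 (z u)) := by
    have : Continuous fun ε : ℝ => z u + ε * k := by fun_prop
    simpa using (this.tendsto 0).mono_left nhdsWithin_le_nhds
  have hne : ∀ᶠ a in 𝓝 (z u), ∀ v, z v ≠ z u → z v ≠ a := by
    refine eventually_all.2 fun v => ?_
    by_cases h : z v = z u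
    · simp [h]
    · filter_upwards [eventually_ne_nhds (Ne.symm h)] with a ha _ using ha.symm
  filter_upwards [hc.eventually (eventually_lt_iff z (z u)), hc.eventually hne,
    self_mem_nhdsWithin] with ε h₁ h₂ (hε : 0 < ε)
  have hεk : ε * k ≠ 0 := mul_ne_zero hε.ne' hk
  refine ⟨fun v => ?_, ?_⟩
  · by_cases hv : z v = z u
    · rw [hv]
      intro h
      exact hεk (by linarith)
    · exact h₂ v hv
  · funext v
    by_cases hv : z v = z u
    · obtain rfl := hz hv
      rcases lt_or_gt_of_ne hk with h | h
      · have : ε * k < 0 := mul_neg_of_pos_of_neg hε h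
        simp [h.not_gt, leftSide, beyond, atLeast, this]
      · have : 0 < ε * k := mul_pos hε h
        simp [h, leftSide, beyond, this.le]
    · rw [leftSide_of_ne hz (fun h => hv (congrArg z h)) _ true]
      exact decide_eq_decide.2 (h₁ v hv)

/-- No other value lies between `b` and `z v`, so an interval from `z u` that covers `b` and ends
elsewhere runs past `z v`. In the application, `z v` is a coordinate of a bend. -/
theorem exists_near_end [Finite V] {z : V → ℝ} (hz : Function.Injective z) {u v : V} (huv : u ≠ v) :
    ∃ b ∈ openSegment ℝ (z u) (z v), (∀ w, z w ≠ b) ∧ ∀ w, w ≠ v →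
      (z u ≤ b ∧ b ≤ z w ∨ z w ≤ b ∧ b ≤ z u) →
      (z u < z v ∧ z v < z w ∨ z w < z v ∧ z v < z u) := by
  have hk : z u - z v ≠ 0 := sub_ne_zero.2 (hz.ne huv)
  have hc : Tendsto (fun ε : ℝ => z v + ε * (z u - z v)) (𝓝[>] 0) (𝓝 (z v)) := by
    have : Continuous fun ε : ℝ => z v + ε * (z u - z v) := by fun_prop
    simpa using (this.tendsto 0).mono_left nhdsWithin_le_nhds
  have h₁ : ∀ᶠ ε in 𝓝[>] (0 : ℝ), ε < 1 := nhdsWithin_le_nhds (gt_mem_nhds one_pos)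
  obtain ⟨ε, h₁, h₂, h₃, (hε : 0 < ε)⟩ := (h₁.and ((hc.eventually (eventually_lt_iff z (z v))).and
    ((eventually_ne_and_beyond hz v hk).and self_mem_nhdsWithin))).exists
  have hε' : 0 < 1 - ε := by linarith
  refine ⟨z v + ε * (z u - z v), ⟨ε, 1 - ε, hε, hε', by ring, by
    simp only [smul_eq_mul]; ring⟩, h₃.1, fun w hw hb => ?_⟩
  have h₄ := h₂ w (hz.ne hw)
  have h₅ := h₃.1 w
  have h₆ := hz.ne hw
  rcases lt_or_gt_of_ne hk with hk | hk
  · have k₁ := mul_neg_of_pos_of_neg hε' hk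
    have k₂ := mul_neg_of_pos_of_neg hε hk
    left
    refine ⟨by linarith, h₄.1 ?_⟩
    rcases hb with hb | hb
    · exact lt_of_le_of_ne hb.2 h₅.symm
    · nlinarith
  · have k₁ := mul_pos hε' hk
    have k₂ := mul_pos hε hk
    right
    refine ⟨lt_of_le_of_ne (not_lt.1 fun h => ?_) h₆, by linarith⟩
    have := h₄.2 h
    rcases hb with hb | hb
    · nlinarith
    · linarith

theorem outerLeftOfSegment_vertical (E : Finset (V × V)) (e : V × V) (c s t : ℝ) :
    OuterLeftOfSegment x y E e (c, s) (c, t) ↔ ∃ b ∈ openSegment ℝ s t,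
      (∀ f ∈ E, f ≠ e → (c, b) ∉ polyline x y f) ∧
      ∀ᶠ ε in 𝓝[>] (0 : ℝ), (c + ε * -(t - s), b) ∈ outerRegion x y E := by
  rw [OuterLeftOfSegment, ← Prod.image_mk_openSegment_right]
  simp only [rotateLeft, Set.exists_mem_image, Prod.mk_sub_mk, sub_self, Prod.smul_mk,
    Prod.mk_add_mk, smul_eq_mul, mul_zero, add_zero]

theorem outerLeftOfSegment_horizontal (E : Finset (V × V)) (e : V × V) (c s t : ℝ) :
    OuterLeftOfSegment x y E e (s, c) (t, c) ↔ ∃ a ∈ openSegment ℝ s t,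
      (∀ f ∈ E, f ≠ e → (a, c) ∉ polyline x y f) ∧
      ∀ᶠ ε in 𝓝[>] (0 : ℝ), (a, c + ε * (t - s)) ∈ outerRegion x y E := by
  rw [OuterLeftOfSegment, ← Prod.image_mk_openSegment_left]
  simp only [rotateLeft, Set.exists_mem_image, Prod.mk_sub_mk, sub_self, Prod.smul_mk,
    Prod.mk_add_mk, smul_eq_mul, mul_zero, add_zero, neg_zero]

theorem outerLeft_iff (d : Dart G.edges) : OuterLeft x y d ↔
    (∃ b ∈ openSegment ℝ (y d.vertex) (y d.flip.vertex),
      (∀ f ∈ G.edges, f ≠ d.edge → (x d.edge.1, b) ∉ polyline x y f) ∧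
      ∀ᶠ ε in 𝓝[>] (0 : ℝ),
        (x d.edge.1 + ε * -(y d.flip.vertex - y d.vertex), b) ∈ outerRegion x y G.edges) ∨
    (∃ a ∈ openSegment ℝ (x d.vertex) (x d.flip.vertex),
      (∀ f ∈ G.edges, f ≠ d.edge → (a, y d.edge.2) ∉ polyline x y f) ∧
      ∀ᶠ ε in 𝓝[>] (0 : ℝ),
        (a, y d.edge.2 + ε * (x d.flip.vertex - x d.vertex)) ∈ outerRegion x y G.edges) := by
  rw [← outerLeftOfSegment_vertical, ← outerLeftOfSegment_horizontal]
  rcases d with ⟨e, s⟩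
  cases s
  · rfl
  · exact or_comm

theorem between_of_mem_openSegment {a b c : ℝ} (hab : a ≠ b) (h : c ∈ openSegment ℝ a b) :
    (decide (c < b) ≠ decide (c < a)) ∧ (c < b ↔ a < b) := by
  rw [openSegment_eq_Ioo' hab] at h
  obtain ⟨h₁, h₂⟩ := h
  rcases lt_or_gt_of_ne hab with h | h
  · rw [min_eq_left h.le] at h₁
    rw [max_eq_right h.le] at h₂
    simp [h, h₁.le, h₂]
  · rw [min_eq_right h.le] at h₁
    rw [max_eq_left h.le] at h₂
    simp [h₂, h₁.not_gt, h.not_gt]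

theorem winding_jump_vertical (hx : Function.Injective x) (hy : Function.Injective y)
    {d : Dart G.edges} {b : ℝ} (hb : b ∈ openSegment ℝ (y d.vertex) (y d.flip.vertex))
    (hf : ∀ f ∈ G.edges, f ≠ d.edge → (x d.edge.1, b) ∉ polyline x y f) :
    ∃ A, Upper x A ∧
      (triMap hG).winding (leftSide (decide (0 < -(y d.flip.vertex - y d.vertex))) x d.edge.1)
        (beyond y b) d = (triMap hG).winding A (beyond y b) d + 1 := by
  have hne : y d.vertex ≠ y d.flip.vertex := hy.ne (vertex_flip_ne d).symm
  obtain ⟨h₁, h₂⟩ := between_of_mem_openSegment hne hb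
  have := (triMap hG).winding_jump_left hx (B := beyond y b) (d := d) h₁ (fun c h₃ h₄ h₅ => by
    by_contra hc
    have h₆ := mem_vertical_of_ne (x := x) hc
    rw [tl_eq, tl_eq] at h₅
    rw [h₅] at h₆
    refine hf c.edge (edge_mem c) (fun h => ?_) (Or.inl h₆)
    rcases edge_eq_iff.1 h with h | h
    · exact h₃ h
    · exact h₄ h)
  refine ⟨_, upper_leftSide (beyond y b d.flip.vertex) x d.edge.1, ?_⟩
  rw [tl_eq] at this
  refine Eq.trans ?_ this
  congr 2
  simp only [triMap_far, beyond, h₂]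
  rw [← decide_not, decide_eq_decide]
  constructor
  · intro h; linarith
  · intro h; have := lt_of_le_of_ne (not_lt.1 h) hne.symm; linarith

theorem winding_jump_horizontal (hx : Function.Injective x) (hy : Function.Injective y)
    {d : Dart G.edges} {a : ℝ} (ha : a ∈ openSegment ℝ (x d.vertex) (x d.flip.vertex))
    (hf : ∀ f ∈ G.edges, f ≠ d.edge → (a, y d.edge.2) ∉ polyline x y f) :
    ∃ B, Upper y B ∧
      (triMap hG).winding (beyond x a)
        (leftSide (decide (0 < x d.flip.vertex - x d.vertex)) y d.edge.2) d =
      (triMap hG).winding (beyond x a) B d + 1 := by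
  have hne : x d.vertex ≠ x d.flip.vertex := hx.ne (vertex_flip_ne d).symm
  obtain ⟨h₁, h₂⟩ := between_of_mem_openSegment hne ha
  have := (triMap hG).winding_jump_right hy (A := beyond x a) (d := d) h₁ (fun c h₃ h₄ h₅ => by
    by_contra hc
    have h₆ := mem_horizontal_of_ne (y := y) hc
    rw [hd_eq, hd_eq] at h₅
    rw [h₅] at h₆
    refine hf c.edge (edge_mem c) (fun h => ?_) (Or.inr h₆)
    rcases edge_eq_iff.1 h with h | h
    · exact h₃ h
    · exact h₄ h)
  refine ⟨_, upper_leftSide (!beyond x a d.flip.vertex) y d.edge.2, ?_⟩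
  rw [hd_eq] at this
  refine Eq.trans ?_ this
  congr 2
  simp only [triMap_far, beyond, h₂, sub_pos]

variable [Finite V] [Fintype (Dart G.edges)]

/-- The winding number is 0 on the left, so it is -1 on the right, and only the clockwise face has a
negative winding number. -/
theorem turn_of_outerLeft (h : (triMap hG).Good x y) {d : Dart G.edges} (hd : OuterLeft x y d) :
    (triMap hG).turn x y d = -4 := by
  have hne := (vertex_flip_ne d).symm
  rcases (outerLeft_iff d).1 hd with ⟨b, hb, hf, hε⟩ | ⟨a, ha, hf, hε⟩
  · obtain ⟨A, hA, hw⟩ := winding_jump_vertical hG h.x_inj h.y_inj hb hf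
    have hk : -(y d.flip.vertex - y d.vertex) ≠ 0 :=
      neg_ne_zero.2 (sub_ne_zero.2 (h.y_inj.ne hne.symm))
    obtain ⟨ε, h₁, -, h₂⟩ := (hε.and (eventually_ne_and_beyond h.x_inj d.edge.1 hk)).exists
    have h₃ := windingAt_eq_zero_of_mem_outerRegion hG d h₁
    rw [windingAt, h₂, hw] at h₃
    have := h.winding hA (upper_beyond y b) d
    omega
  · obtain ⟨B, hB, hw⟩ := winding_jump_horizontal hG h.x_inj h.y_inj ha hf
    have hk : x d.flip.vertex - x d.vertex ≠ 0 := sub_ne_zero.2 (h.x_inj.ne hne.symm)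
    obtain ⟨ε, h₁, -, h₂⟩ := (hε.and (eventually_ne_and_beyond h.y_inj d.edge.2 hk)).exists
    have h₃ := windingAt_eq_zero_of_mem_outerRegion hG d h₁
    rw [windingAt, h₂, hw] at h₃
    have := h.winding (upper_beyond x a) hB d
    omega

theorem outerLeft_of_turn (h : (triMap hG).Good x y) {d : Dart G.edges}
    (ht : (triMap hG).turn x y d = -4) : OuterLeft x y d := by
  have hne := (vertex_flip_ne d).symm
  have hse : d.edge.1 ≠ d.edge.2 := fun h' => G.loopless d.edge.1 (by
    have := edge_mem d
    rwa [← Prod.mk.eta (p := d.edge), ← h'] at this)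
  rw [outerLeft_iff]
  -- A point on no other edge is sought next to the bend. If another vertical segment at the tail
  -- runs past the bend, then a horizontal segment running past it would cross that one, so the
  -- horizontal side is free. Otherwise the vertical side is free.
  by_cases hV : ∃ v', (d.edge.1, v') ∈ G.edges ∧ v' ≠ d.edge.2 ∧
      (y d.edge.1 < y d.edge.2 ∧ y d.edge.2 < y v' ∨ y v' < y d.edge.2 ∧ y d.edge.2 < y d.edge.1)
  · right
    obtain ⟨v', hv', -, hv⟩ := hV
    obtain ⟨a, ha, ha', hw⟩ := exists_near_end h.x_inj hse.symm
    have ha'' : a ∈ openSegment ℝ (x d.vertex) (x d.flip.vertex) := by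
      rcases vertex_or d with ⟨e₁, e₂⟩ | ⟨e₁, e₂⟩ <;> rw [e₁, e₂]
      · rwa [openSegment_symm]
      · exact ha
    have hf : ∀ f ∈ G.edges, f ≠ d.edge → (a, y d.edge.2) ∉ polyline x y f := by
      rintro f hf hfe (hp | hp)
      · exact ha' _ (mem_vertical_iff.1 hp).1.symm
      · obtain ⟨h₁, h₂⟩ := mem_horizontal_iff.1 hp
        have e₁ : d.edge.2 = f.2 := h.y_inj h₁
        have e₂ : f.1 ≠ d.edge.1 := fun h' => hfe (Prod.ext h' e₁.symm)
        rw [← e₁] at h₂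
        have h₃ := hw f.1 e₂ h₂.symm
        refine h.no_cross (e := (⟨_, hv'⟩, EdgeSide.tail)) (f := (⟨f, hf⟩, EdgeSide.head)) rfl rfl
          ?_ ?_
        · change y d.edge.1 < y f.2 ∧ y f.2 < y v' ∨ y v' < y f.2 ∧ y f.2 < y d.edge.1
          rwa [← e₁]
        · change x f.1 < x d.edge.1 ∧ x d.edge.1 < x f.2 ∨ x f.2 < x d.edge.1 ∧ x d.edge.1 < x f.1
          rw [← e₁]
          exact h₃.symm
    obtain ⟨B, hB, hj⟩ := winding_jump_horizontal hG h.x_inj h.y_inj ha'' hf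
    have hk : x d.flip.vertex - x d.vertex ≠ 0 := sub_ne_zero.2 (h.x_inj.ne hne.symm)
    refine ⟨a, ha'', hf, ?_⟩
    filter_upwards [eventually_ne_and_beyond h.y_inj d.edge.2 hk] with ε hε
    refine mem_outerRegion_of_windingAt_eq_zero hG h ht ha' hε.1 ?_
    rw [windingAt, hε.2]
    dsimp only
    -- Both winding numbers are 0 or -1 and the left one is larger by one, so it vanishes.
    have h₁ := h.winding (upper_beyond x a) hB d
    have h₂ := h.winding (upper_beyond x a)
      (upper_leftSide (decide (0 < x d.flip.vertex - x d.vertex)) y d.edge.2) d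
    omega
  · left
    obtain ⟨b, hb, hb', hw⟩ := exists_near_end h.y_inj hse
    have hb'' : b ∈ openSegment ℝ (y d.vertex) (y d.flip.vertex) := by
      rcases vertex_or d with ⟨e₁, e₂⟩ | ⟨e₁, e₂⟩ <;> rw [e₁, e₂]
      · exact hb
      · rwa [openSegment_symm]
    have hf : ∀ f ∈ G.edges, f ≠ d.edge → (x d.edge.1, b) ∉ polyline x y f := by
      rintro f hf hfe (hp | hp)
      · obtain ⟨h₁, h₂⟩ := mem_vertical_iff.1 hp
        have e₁ : d.edge.1 = f.1 := h.x_inj h₁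
        have e₂ : f.2 ≠ d.edge.2 := fun h' => hfe (Prod.ext e₁.symm h')
        rw [← e₁] at h₂
        exact hV ⟨f.2, by rw [e₁]; exact hf, e₂, hw f.2 e₂ h₂⟩
      · exact hb' _ (mem_horizontal_iff.1 hp).1.symm
    obtain ⟨A, hA, hj⟩ := winding_jump_vertical hG h.x_inj h.y_inj hb'' hf
    have hk : -(y d.flip.vertex - y d.vertex) ≠ 0 :=
      neg_ne_zero.2 (sub_ne_zero.2 (h.y_inj.ne hne.symm))
    refine ⟨b, hb'', hf, ?_⟩
    filter_upwards [eventually_ne_and_beyond h.x_inj d.edge.1 hk] with ε hε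
    refine mem_outerRegion_of_windingAt_eq_zero hG h ht hε.1 hb' ?_
    rw [windingAt, hε.2]
    dsimp only
    have h₁ := h.winding hA (upper_beyond y b) d
    have h₂ := h.winding
      (upper_leftSide (decide (0 < -(y d.flip.vertex - y d.vertex))) x d.edge.1)
      (upper_beyond y b) d
    omega

theorem outerLeft_iff_turn (h : (triMap hG).Good x y) (d : Dart G.edges) :
    OuterLeft x y d ↔ (triMap hG).turn x y d = -4 :=
  ⟨turn_of_outerLeft hG h, outerLeft_of_turn hG h⟩

end PlaneDigraph

/-! ### Transfer of planarity and the theorem -/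

namespace PlaneDigraph

variable {V : Type*} {G : PlaneDigraph V} (hG : G.IsTriangulated) {x y : V → ℝ}

open LDrawing TriMap

/-- `Good`, the descents of the rotation and the turns of the faces depend only on comparisons along
edges; they yield the absence of crossings, the cyclic orders and the outer face, respectively. -/
theorem isPlanarLDrawing_congr [Finite V] {x' y' : V → ℝ} (h : IsPlanarLDrawing x y G)
    (ix : Function.Injective x') (iy : Function.Injective y')
    (hx : ∀ d, (triMap hG).up x' d = (triMap hG).up x d)
    (hy : ∀ d, (triMap hG).up y' d = (triMap hG).up y d) : IsPlanarLDrawing x' y' G := by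
  have := Fintype.ofFinite (Dart G.edges)
  have hg := good_of_isPlanar hG h.x_injective h.y_injective h.nonCrossing h.rotation
  have hg' := good_congr h.x_injective h.y_injective ix iy hx hy hg
  have ht := turn_congr h.x_injective h.y_injective ix iy hx hy
  refine ⟨ix, iy, nonCrossing_of_good hG hg', respectsRotation_of_descents hG ix iy ?_, fun d => ?_⟩
  · simp only [before_rot_congr h.x_injective h.y_injective ix iy hx hy]
    exact existsUnique_descent_of_respectsRotation hG h.x_injective h.y_injective h.rotation
  · rw [outerLeft_iff_turn hG hg', ht, ← outerLeft_iff_turn hG hg, h.outer]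

end PlaneDigraph

theorem mainTheorem5 {V : Type*} [Finite V] (G : PlaneDigraph V) (hG : G.IsTriangulated)
    (P : PortAssignment G) (hP : P.AdmitsPlanarLDrawing) :
    P.digraphX.IsAcyclic ∧ P.digraphY.IsAcyclic ∧
    ∀ x y : V → ℝ, P.digraphX.IsTopologicalOrdering x → P.digraphY.IsTopologicalOrdering y →
      LDrawing.IsPlanarLDrawing x y G ∧ LDrawing.Realizes x y P := by
  obtain ⟨x₀, y₀, h, hr⟩ := hP
  obtain ⟨hX, hY⟩ := (PlaneDigraph.realizes_iff h.x_injective h.y_injective P).1 hr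
  refine ⟨PlaneDigraph.isAcyclic_of_lt hX, PlaneDigraph.isAcyclic_of_lt hY, fun x y hx hy => ?_⟩
  refine ⟨PlaneDigraph.isPlanarLDrawing_congr hG h hx.injective hy.injective
    (PlaneDigraph.up_congr hG (PlaneDigraph.adjX_or P) hX hx.lt_of_adj)
    (PlaneDigraph.up_congr hG (PlaneDigraph.adjY_or P) hY hy.lt_of_adj), ?_⟩
  exact (PlaneDigraph.realizes_iff hx.injective hy.injective P).2 ⟨hx.lt_of_adj, hy.lt_of_adj⟩
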